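/- **Setting.** Let $2\le k\le n$. For $0\le l\le n$ let $S^l_n$ be the set of permutations $\gamma$ of $\{1,\dots,n\}$ that are increasing on $\{1,\dots,l\}$ and on $\{l+1,\dots,n\}$. Fix $\sigma\in S^k_n$ and, for $l\le k$, put $S^{l,\sigma}_n=\{\gamma\in S^l_n:\{\sigma(i):i>k\}\subseteq\{\gamma(i):i>l\}\}$. For $1\le l\le k$ and $\gamma\in S^{l,\sigma}_n$ let $$\mathbb S^{l-1,\gamma}_{>0}=\Big\{c\in\mathbb R^n:\ \textstyle\sum_i c_i^2=1,\ c_{\gamma(i)}>0\ (i\le l),\ c_{\gamma(i)}=0\ (i>l)\Big\}.$$ On $\mathbb R^{2n}$ with coordinates $(x_i,y_i)_{i\le n}$ put $\rho_i=\sqrt{x_i^2+y_i^2}$, $\mathcal M_{l,\gamma}=\{\rho_{\gamma(i)}\ne0\ (i\le l),\ \rho_{\gamma(i)}=0\ (i>l)\}$, and, for $C\in\mathbb S^{l-1,\gamma}_{>0}$, let the leaf $\mathcal M^C_{l,\gamma}$ be the set of points of $\mathcal M_{l,\gamma}$ with $(\rho_1,\dots,\rho_n)/\|(\rho_1,\dots,\rho_n)\|=C$.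 Let $\omega_i\neq0$ and $a_i$ ($i\le n$) be real numbers such that $a_{\sigma(i)}a_{\sigma(j)}>0$ for all $1\le i<j\le k$, and for $\nu\in\mathbb R$ consider $$\dot x_i=-\omega_iy_i+g\,x_i,\qquad \dot y_i=\omega_ix_i+g\,y_i,\qquad g=\nu+\sum_{j=1}^n a_j(x_j^2+y_j^2),\qquad 1\le i\le n,\tag{1}$$ on the invariant closed cell $D=\overline{\mathcal M_{k,\sigma}}$. Write $\mathbb T_A=(\mathbb S^1)^A$ for a finite set $A$ of circle labels. Let $\mathcal Q$ be the quotient of $\mathbb T_{\{\sigma(1),\dots,\sigma(k)\}}\times\overline{\mathbb S^{k-1,\sigma}_{>0}}$ by the equivalence relation generated by $(s,c)\sim(s',c)$ whenever $c\in\mathbb S^{l-1,\gamma}_{>0}$ for some $1\le l<k$, $\gamma\in S^{l,\sigma}_n$, and $s_{\gamma(i)}=s'_{\gamma(i)}$ for all $i\le l$. A *toral CW complex* over a finite regular CW complex $\tilde X$ is a Hausdorff space $X$ partitioned into toral cells $\mathfrak C_e$, one for each cell $e$ of $\tilde X$, together with the following data. Each $d$-cell $e$ has a set $A_e$ of $d+1$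 or $d+2$ circle labels, with an injection $A_{e'}\hookrightarrow A_e$ for every face $e'$ of $e$; the dimension of $\mathfrak C_e$ is $d+|A_e|$. There are homeomorphisms $g_e:\mathfrak C_e\to\mathbb T_{A_e}\times e$ and attaching homeomorphisms $\Phi_e:Z_e\to\overline{\mathfrak C_e}$. Here $Z_e$ is the quotient of $\mathbb T_{A_e}\times\overline{\mathbb B^d}$ in which, over each point $z$ whose image under the characteristic map $\tilde\Phi_e$ lies in a face $e'$, the circle factors not belonging to $A_{e'}$ are collapsed. Over the open ball $\Phi_e$ takes values in $\mathfrak C_e$ and $g_e(\Phi_e(s,z))=(s,\tilde\Phi_e(z))$; over the boundary sphere $\Phi_e$ takes values in toral cells of smaller dimension. A value $\nu^*$ is a *cell-bifurcation value* if every neighbourhood of $\nu^*$ contains some $\nu$ for which the dynamics of (1) on $D$ is not topologically (orbitally) equivalent to that for $\nu^*$. A set is *flow-invariant* if it is invariant forward and backward in time. All stability notions are relative to the phase space $D$. **Theorem.** 1. $\nu=0$ is a cell-bifurcation value. 2. $\overline{\mathbb S^{k-1,\sigma}_{>0}}$ is a finite regular CW complex whose open $l$-cells are the sets $\mathbb S^{l,\gamma}_{>0}$,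 $\gamma\in S^{l+1,\sigma}_n$, $0\le l\le k-1$. For every $\nu$ with $a_{\sigma(k)}\nu<0$ there is a flow-invariant set $X_\nu\subseteq D\setminus\{0\}$, and these sets shrink to the origin as $\nu\to0$, such that: - (a) for $1\le l\le k$, $\gamma\in S^{l,\sigma}_n$ and $C\in\mathbb S^{l-1,\gamma}_{>0}$, the set $X_\nu\cap\mathcal M^C_{l,\gamma}$ is flow-invariant and is a Clifford $l$-torus $\{\rho_i=rC_i\ \text{for all } i\}$ for some $r>0$; - (b) $X_\nu$ is a toral CW complex over this CW complex; the toral cell over $\mathbb S^{l,\gamma}_{>0}$ is $X_\nu\cap\mathcal M_{l+1,\gamma}$ and is homeomorphic to $\mathbb T_{l+1}\times\mathbb S^{l,\gamma}_{>0}$ (so there are no even-dimensional toral cells); - (c) there is a homeomorphism $\mathcal Q\to X_\nu$ that maps the class of $(s,C)$ into the leaf $\mathcal M^C_{l,\gamma}$ for every $C\in\mathbb S^{l-1,\gamma}_{>0}$, $\gamma\in S^{l,\sigma}_n$, $1\le l\le k$; in particular it respects the partitions into toral cells. If $a_{\sigma(k)}\nu\ge0$, no flow-invariant subset of $D$ is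 homeomorphic to $\mathcal Q$. 3. Let $a_{\sigma(k)}\nu<0$. Then $X_\nu$ is asymptotically stable if and only if $a_{\sigma(k)}<0$. If $a_{\sigma(k)}>0$, it is (Lyapunov) unstable and, moreover, there is a neighbourhood of $X_\nu$ that every trajectory in $D\setminus X_\nu$ leaves in forward time. 4. Let $a_{\sigma(k)}\nu<0$, $1\le l\le k$, $\gamma\in S^{l,\sigma}_n$, and consider the trajectory through a point $p\in\mathcal M_{l,\gamma}$ at time $0$; let $C$ be the direction $(\rho_1,\dots,\rho_n)/\|(\rho_1,\dots,\rho_n)\|$ of $p$. If $a_{\sigma(k)}<0$, it exists for all $t\ge0$ and converges to $X_\nu$ as $t\to\infty$; if $a_{\sigma(k)}>0$, it exists for all $t\le0$ and converges to $X_\nu$ as $t\to-\infty$. As long as it exists it stays in $\mathcal M^C_{l,\gamma}$, and for $i\le l$ the pair $(x_{\gamma(i)},y_{\gamma(i)})$ rotates with constant angular velocity $\omega_{\gamma(i)}$ (frequency $\omega_{\gamma(i)}/2\pi$), while $$\dot\rho_{\gamma(i)}=\frac{c_{\gamma(i)}}{c_{\gamma(l)}}\,\rho_{\gamma(l)}\Big(\nu+\rho_{\gamma(l)}^2\sum_{j=1}^n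 a_j\frac{c_j^2}{c_{\gamma(l)}^2}\Big).$$ -/

import Mathlib

open Set Filter Topology Metric

noncomputable section

/-! ## Index permutations and positive spherical cells

Positions are counted from `0`: the positions `1, …, k` are the `i : Fin n` with `i.val < k`. -/

/-- `S^k_n`: permutations increasing on the first `k` positions and on the remaining ones. -/
def shuffles (n k : ℕ) : Set (Equiv.Perm (Fin n)) :=
  {σ | ∀ i j : Fin n, i < j → (j.val < k ∨ k ≤ i.val) → σ i < σ j}

/-- `S^{l,σ}_n` for `σ ∈ S^k_n`, `l ≤ k`. -/
def subShuffles (n k : ℕ) (σ : Equiv.Perm (Fin n)) (l : ℕ) : Set (Equiv.Perm (Fin n)) :=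
  {γ | γ ∈ shuffles n l ∧ l ≤ k ∧ ∀ i : Fin n, k ≤ i.val → ∃ j : Fin n, l ≤ j.val ∧ γ j = σ i}

/-- `𝕊^{l-1,γ}_{>0}`: unit vectors whose coordinates `γ(1), …, γ(l)` are positive and whose other
coordinates vanish. -/
def spherePos (n l : ℕ) (γ : Equiv.Perm (Fin n)) : Set (Fin n → ℝ) :=
  {c | (∀ i : Fin n, i.val < l → 0 < c (γ i)) ∧ (∀ i : Fin n, l ≤ i.val → c (γ i) = 0) ∧
    ∑ i, c i ^ 2 = 1}

/-! ## State space, cells and leaves -/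

/-- `ℝ^{2n}` with points `(x, y) = (x₁, …, xₙ, y₁, …, yₙ)`. -/
abbrev State (n : ℕ) : Type := (Fin n → ℝ) × (Fin n → ℝ)

/-- `ρ_i = ‖(x_i, y_i)‖`. -/
def radius {n : ℕ} (p : State n) (i : Fin n) : ℝ := Real.sqrt (p.1 i ^ 2 + p.2 i ^ 2)

/-- The direction `C = (ρ₁, …, ρₙ) / ‖(x, y)‖` of a nonzero state. -/
def direction {n : ℕ} (p : State n) : Fin n → ℝ :=
  fun i => radius p i / Real.sqrt (∑ j, radius p j ^ 2)

/-- The open `2l`-cell `M_{l,γ}`. -/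
def stateCell (n l : ℕ) (γ : Equiv.Perm (Fin n)) : Set (State n) :=
  {p | (∀ i : Fin n, i.val < l → (p.1 (γ i), p.2 (γ i)) ≠ (0, 0)) ∧
    ∀ i : Fin n, l ≤ i.val → (p.1 (γ i), p.2 (γ i)) = (0, 0)}

/-- The leaf `M^C_{l,γ}`. -/
def leaf (n l : ℕ) (γ : Equiv.Perm (Fin n)) (C : Fin n → ℝ) : Set (State n) :=
  {p | p ∈ stateCell n l γ ∧ direction p = C}

/-! ## The truncated Eulerian normal form and its flow -/

/-- The vector field
`∑ ω_i (x_i ∂_{y_i} - y_i ∂_{x_i}) + (ν + ∑_j a_j (x_j² + y_j²)) ∑_i (x_i ∂_{x_i} + y_i ∂_{y_i})`. -/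
def eulerField {n : ℕ} (ω a : Fin n → ℝ) (ν : ℝ) (p : State n) : State n :=
  (fun i => -(ω i) * p.2 i + (ν + ∑ j, a j * (p.1 j ^ 2 + p.2 j ^ 2)) * p.1 i,
   fun i => ω i * p.1 i + (ν + ∑ j, a j * (p.1 j ^ 2 + p.2 j ^ 2)) * p.2 i)

section Dynamics

variable {E : Type*} [NormedAddCommGroup E] [NormedSpace ℝ E]

/-- `x` solves `x' = V(x)` on the time set `J`. -/
def Solves (V : E → E) (x : ℝ → E) (J : Set ℝ) : Prop :=
  IsIntegralCurveOn x (fun _ => V) J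

/-- `A` is invariant, forward and backward in time, under the (local) flow of `V`. -/
def IsFlowInvariant (V : E → E) (A : Set E) : Prop :=
  ∀ (x : ℝ → E) (J : Set ℝ), J.OrdConnected → (0 : ℝ) ∈ J → Solves V x J → x 0 ∈ A →
    ∀ t ∈ J, x t ∈ A

/-- `x(t)` converges to the set `A` as `t → l`. -/
def ConvergesToSet (x : ℝ → E) (l : Filter ℝ) (A : Set E) : Prop :=
  ∀ U ∈ 𝓝ˢ A, ∀ᶠ t in l, x t ∈ U

/-- Lyapunov stability of `A` for the dynamics of `V` on the phase space `D`. -/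
def LyapunovStableOn (V : E → E) (D A : Set E) : Prop :=
  ∀ U ∈ 𝓝ˢ A, ∃ W ∈ 𝓝ˢ A, ∀ (x : ℝ → E) (T : ℝ), Solves V x (Icc 0 T) → x 0 ∈ W ∩ D →
    ∀ t ∈ Icc 0 T, x t ∈ U

/-- Local attractivity of `A` for the dynamics of `V` on `D`: near `A` forward solutions exist for
all times and converge to `A`. -/
def AttractiveOn (V : E → E) (D A : Set E) : Prop :=
  ∃ W ∈ 𝓝ˢ A, ∀ p ∈ W ∩ D, (∃ x : ℝ → E, Solves V x (Ici 0) ∧ x 0 = p) ∧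
    ∀ x : ℝ → E, Solves V x (Ici 0) → x 0 = p → ConvergesToSet x atTop A

/-- Asymptotic stability of `A` for the dynamics of `V` on `D`. -/
def AsymptoticallyStableOn (V : E → E) (D A : Set E) : Prop :=
  LyapunovStableOn V D A ∧ AttractiveOn V D A

/-- `h` maps the solution arcs of `V` in `D` to solution arcs of `W`, up to an increasing
reparametrization of time. -/
def MapsOrbits (V W : E → E) (D : Set E) (h : D → D) : Prop :=
  ∀ (x : ℝ → E) (T : ℝ), 0 ≤ T → Solves V x (Icc 0 T) → ∀ hx : ∀ t ∈ Icc 0 T, x t ∈ D,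
    ∃ (y : ℝ → E) (τ : ℝ → ℝ), ContinuousOn τ (Icc 0 T) ∧ StrictMonoOn τ (Icc 0 T) ∧ τ 0 = 0 ∧
      Solves W y (Icc 0 (τ T)) ∧ ∀ (t : ℝ) (ht : t ∈ Icc 0 T), y (τ t) = h ⟨x t, hx t ht⟩

/-- Topological (orbital) equivalence of the dynamics of `V` and of `W` on `D`. -/
def TopEquivalentOn (V W : E → E) (D : Set E) : Prop :=
  ∃ h : D ≃ₜ D, MapsOrbits V W D h ∧ MapsOrbits W V D h.symm

/-- `μ₀` is a bifurcation value of the family `V` on `D`: arbitrarily close to `μ₀` there are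
parameters whose dynamics on `D` is not topologically equivalent to that at `μ₀`. -/
def IsBifurcationValueOn (V : ℝ → E → E) (D : Set E) (μ₀ : ℝ) : Prop :=
  ∀ U ∈ 𝓝 μ₀, ∃ μ ∈ U, ¬ TopEquivalentOn (V μ) (V μ₀) D

end Dynamics

/-! ## Toral CW complexes -/

section Toral

variable {B : Type} [TopologicalSpace B] (C : Set B) [Topology.CWComplex C]

/-- The cells of a CW complex, with their dimension as first component. -/
abbrev CWCells : Type := Σ d : ℕ, Topology.CWComplex.cell C d

variable {C}

/-- The open cell `e`. -/
abbrev cwOpen (e : CWCells C) : Set B := Topology.CWComplex.openCell (C := C) e.1 e.2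

/-- `e'` lies in the closure of `e`. -/
def IsFace (e' e : CWCells C) : Prop :=
  cwOpen e' ⊆ Topology.CWComplex.closedCell (C := C) e.1 e.2

/-- Let the torus over the cell `e` have the circle factors `circ e`, and let the circle factors of
a face correspond to some of those of `e`. Two points of (torus) × (closed ball) are identified when
they have the same base point `x` and agree in all circle factors that belong to the face that
contains the image of `x`; the other factors collapse to a point. -/
def collapse (circ : CWCells C → Type)
    (incl : ∀ e' e : CWCells C, IsFace e' e → (circ e' ↪ circ e)) (e : CWCells C) :
    Setoid ((circ e → Circle) × closedBall (0 : Fin e.1 → ℝ) 1) where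
  r u v := u.2 = v.2 ∧ ∀ (e' : CWCells C) (h : IsFace e' e),
    Topology.CWComplex.map (C := C) e.1 e.2 u.2 ∈ cwOpen e' →
      ∀ m : circ e', u.1 (incl e' e h m) = v.1 (incl e' e h m)
  iseqv :=
    { refl := fun _ => ⟨rfl, fun _ _ _ _ => rfl⟩
      symm := fun h => ⟨h.1.symm, fun e' he hm m => (h.2 e' he (h.1 ▸ hm) m).symm⟩
      trans := fun h h' => ⟨h.1.trans h'.1, fun e' he hm m =>
        (h.2 e' he hm m).trans (h'.2 e' he (h.1 ▸ hm) m)⟩ }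

variable (C)

/-- A toral CW complex structure on the space `X`, associated with the finite regular CW complex
`C`. A `d`-cell `e` of `C` carries a torus of dimension `d + 1` (odd toral cell) or `d + 2` (even
toral cell); the toral cells partition `X`. The space that is attached for `e` is the closure of
(torus) × (open ball), that is (torus) × (closed ball) with circle factors collapsed over the
boundary. -/
structure ToralCWComplex (X : Type) [TopologicalSpace X] where
  hausdorff : T2Space X
  finite_cells : Finite (CWCells C)
  /-- The characteristic maps of `C` are injective on the closed balls, i.e. `C` is regular. -/
  regular : ∀ e : CWCells C,
    InjOn (Topology.CWComplex.map (C := C) e.1 e.2) (closedBall (0 : Fin e.1 → ℝ) 1)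
  /-- The circle factors of the torus over a cell. -/
  circ : CWCells C → Type
  finite_circ : ∀ e, Finite (circ e)
  card_circ : ∀ e, Nat.card (circ e) = e.1 + 1 ∨ Nat.card (circ e) = e.1 + 2
  /-- Correspondence between the circle factors over a face and some of those over the cell. -/
  incl : ∀ e' e : CWCells C, IsFace e' e → (circ e' ↪ circ e)
  /-- The open toral cells. -/
  toralCell : CWCells C → Set X
  disjoint_cells : Pairwise fun e e' => Disjoint (toralCell e) (toralCell e')
  iUnion_cells : ⋃ e, toralCell e = univ
  /-- Each open toral cell is a torus times the open cell. -/
  triv : ∀ e, toralCell e ≃ₜ (circ e → Circle) × (cwOpen e)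
  /-- The attaching homeomorphisms. -/
  attach : ∀ e, Quotient (collapse circ incl e) ≃ₜ closure (toralCell e)
  /-- The boundary is attached to toral cells of smaller dimension. -/
  attach_boundary : ∀ (e : CWCells C) (s : circ e → Circle)
    (x : closedBall (0 : Fin e.1 → ℝ) 1), (x : Fin e.1 → ℝ) ∈ sphere (0 : Fin e.1 → ℝ) 1 →
      ∃ e' : CWCells C, e'.1 + Nat.card (circ e') < e.1 + Nat.card (circ e) ∧
        (attach e (Quotient.mk _ (s, x)) : X) ∈ toralCell e'
  /-- In the interior the attaching map covers the characteristic map of the cell. -/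
  attach_interior : ∀ (e : CWCells C) (s : circ e → Circle)
    (x : closedBall (0 : Fin e.1 → ℝ) 1), (x : Fin e.1 → ℝ) ∈ ball (0 : Fin e.1 → ℝ) 1 →
      ∃ h : (attach e (Quotient.mk _ (s, x)) : X) ∈ toralCell e,
        (triv e ⟨_, h⟩).1 = s ∧
        ((triv e ⟨_, h⟩).2 : B) = Topology.CWComplex.map (C := C) e.1 e.2 x

end Toral

/-! ## The quotient of `𝕋_k × closure 𝕊^{k-1,σ}_{>0}` -/

/-- The torus `∏_{j ≤ k} 𝕊¹_{σ(j)}`; the circle factors carry the labels `σ(1), …, σ(k)`. -/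
abbrev LabelledTorus (n k : ℕ) (σ : Equiv.Perm (Fin n)) : Type :=
  {m : Fin n // ∃ i : Fin n, i.val < k ∧ σ i = m} → Circle

/-- Over a point `x ∈ 𝕊^{l-1,γ}_{>0}` of the boundary, `l < k` and `γ ∈ S^{l,σ}_n`, points with the
same components `s_{γ(1)}, …, s_{γ(l)}` are identified. -/
def collapseRel (n k : ℕ) (σ : Equiv.Perm (Fin n))
    (u v : LabelledTorus n k σ × closure (spherePos n k σ)) : Prop :=
  u.2 = v.2 ∧ ∃ (l : ℕ) (γ : Equiv.Perm (Fin n)), 1 ≤ l ∧ l < k ∧ γ ∈ subShuffles n k σ l ∧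
    (u.2 : Fin n → ℝ) ∈ spherePos n l γ ∧
    ∀ (i : Fin n) (hi : ∃ i' : Fin n, i'.val < k ∧ σ i' = γ i), i.val < l →
      u.1 ⟨γ i, hi⟩ = v.1 ⟨γ i, hi⟩

/-- The quotient `Y / ∼` of `Y = 𝕋_k × closure 𝕊^{k-1,σ}_{>0}` by the equivalence relation generated
by `collapseRel`, with the quotient topology. -/
abbrev ToralQuotient (n k : ℕ) (σ : Equiv.Perm (Fin n)) : Type := Quot (collapseRel n k σ)

end

/-!
On the closed cell `D = {ρ_i = 0 for i ∉ S}`, where `S` consists of the labels `σ(1), …, σ(k)`, the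
form `q = ∑ a_j ρ_j²` is definite with the sign of `α = a_{σ(k)}`. The set `X_ν` is the ellipsoid
`ν + q = 0` in `D`, on which the field reduces to the rotations.

**Dynamics.** All planes share the radial factor `g = ν + q`, so `Q' = 2 g Q` for every weighted form
`Q = ∑ b_j ρ_j²`. The reciprocal scaling `w = ‖x(0)‖² / ‖x(t)‖²` then satisfies the linear equation
`w' = -2νw - 2q(x(0))`, and every solution is `x(t) = w(t)^{-1/2} R_{ωt} x(0)`, where `R_{ωt}` rotates
the `i`-th plane by `ω_i t` (`Solves.eq_spiral`; conversely `IsScaling.solves`). Uniqueness is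
reduced to scalar linear equations, so it holds on arbitrary intervals. Leaves are invariant because
a scaling does not change the direction. For `ν ≠ 0` one has `w = E + y (1 - E)` with `E = exp (-2νt)`
and `y = -q(x(0)) / ν`, and `ν + q(x(t)) = (ν + q(x(0))) E / w` (`add_quad_spiral`); this identity
gives invariance, stability, convergence and, for `α > 0`, the escape from a fixed neighbourhood.
The sets `|ν + q| < ε` form a neighbourhood base of `X_ν` in `D` by compactness
(`exists_pos_forall_mem`).

**Bifurcation and nonexistence.** If `αν ≥ 0`, the norm is strictly monotone along nonzero solutions
in `D`, so a compact invariant set is contained in `{0}`, whereas the quotient has two points. For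
`αν < 0` there is a periodic orbit in a single plane, which an equivalence cannot carry to an orbit of
the field at `ν = 0`.

**Topology.** The cells of the spherical simplex are the nonempty subsets `A ⊆ S`, with `A` the set
of positive coordinates. The cube is homeomorphic to the solid simplex, and the squares of the
coordinates of a point of a face are its barycentric coordinates; this gives the characteristic maps
(`exists_characteristicMap`). Polar coordinates `(s, c) ↦ (r(c) c_i s_i)_i` map
(torus) × (closed face) onto the part of `X_ν` over the closed face, and two points have the same image
exactly if they have the same `c` and the same `s_i` wherever `c_i ≠ 0` (`polarPoint_ell_eq_iff`).
This is both the relation that collapses the circle factors of the toral complex and the relation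
that defines the quotient, so the induced continuous bijections between compact Hausdorff spaces are
homeomorphisms.
-/

noncomputable section

/-! ### Solutions of the Eulerian normal form -/

/-- The weighted quadratic form `∑ b_j (x_j² + y_j²)`. -/
def quad {n : ℕ} (b : Fin n → ℝ) (p : State n) : ℝ := ∑ j, b j * (p.1 j ^ 2 + p.2 j ^ 2)

/-- The point `p`, with its `i`-th plane rotated by the angle `ω i * t`, scaled by `lam`. -/
def spiral {n : ℕ} (ω : Fin n → ℝ) (lam t : ℝ) (p : State n) : State n :=
  (fun i => lam * (Real.cos (ω i * t) * p.1 i - Real.sin (ω i * t) * p.2 i),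
   fun i => lam * (Real.sin (ω i * t) * p.1 i + Real.cos (ω i * t) * p.2 i))

lemma continuous_quad {n : ℕ} (b : Fin n → ℝ) : Continuous (quad b) := by
  unfold quad; fun_prop

lemma spiral_sq {n : ℕ} (ω : Fin n → ℝ) (lam t : ℝ) (p : State n) (i : Fin n) :
    (spiral ω lam t p).1 i ^ 2 + (spiral ω lam t p).2 i ^ 2 =
      lam ^ 2 * (p.1 i ^ 2 + p.2 i ^ 2) := by
  simp only [spiral]
  linear_combination lam ^ 2 * (p.1 i ^ 2 + p.2 i ^ 2) * Real.cos_sq_add_sin_sq (ω i * t)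

lemma quad_spiral {n : ℕ} (b ω : Fin n → ℝ) (lam t : ℝ) (p : State n) :
    quad b (spiral ω lam t p) = lam ^ 2 * quad b p := by
  simp only [quad, spiral_sq, Finset.mul_sum]
  exact Finset.sum_congr rfl fun i _ => by ring

lemma radius_spiral {n : ℕ} (ω : Fin n → ℝ) {lam : ℝ} (hlam : 0 ≤ lam) (t : ℝ) (p : State n)
    (i : Fin n) : radius (spiral ω lam t p) i = lam * radius p i := by
  rw [radius, spiral_sq, Real.sqrt_mul (sq_nonneg _), Real.sqrt_sq hlam, radius]

/-- Forward uniqueness of the zero solution of a scalar linear equation. -/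
lemma linear_ode_eq_zero_of_nonneg {J : Set ℝ} (hJ : J.OrdConnected) (h0 : (0 : ℝ) ∈ J)
    {f g : ℝ → ℝ} (hg : ContinuousOn g J)
    (hf : ∀ t ∈ J, HasDerivWithinAt f (g t * f t) J t) (hf0 : f 0 = 0) {t : ℝ} (ht : t ∈ J)
    (ht0 : 0 ≤ t) : f t = 0 := by
  have hsub : Icc 0 t ⊆ J := hJ.out h0 ht
  obtain ⟨K, hK⟩ := isCompact_Icc.exists_bound_of_continuousOn (hg.mono hsub)
  have := norm_le_gronwallBound_of_norm_deriv_right_le (f := f) (f' := fun s => g s * f s)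
    (δ := 0) (K := K) (ε := 0) (a := 0) (b := t)
    (fun s hs => ((hf s (hsub hs)).mono hsub).continuousWithinAt)
    (fun s hs => ((hf s (hsub (Ico_subset_Icc_self hs))).mono hsub).mono_of_mem_nhdsWithin
      (Icc_mem_nhdsGE_of_mem hs)) (by simp [hf0])
    (fun s hs => by
      rw [norm_mul, add_zero]
      exact mul_le_mul_of_nonneg_right (hK s (Ico_subset_Icc_self hs)) (norm_nonneg _))
    t (right_mem_Icc.2 ht0)
  simpa [gronwallBound_ε0] using this

lemma linear_ode_eq_zero {J : Set ℝ} (hJ : J.OrdConnected) (h0 : (0 : ℝ) ∈ J)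
    {f g : ℝ → ℝ} (hg : ContinuousOn g J)
    (hf : ∀ t ∈ J, HasDerivWithinAt f (g t * f t) J t) (hf0 : f 0 = 0) {t : ℝ} (ht : t ∈ J) :
    f t = 0 := by
  rcases le_total 0 t with ht0 | ht0
  · exact linear_ode_eq_zero_of_nonneg hJ h0 hg hf hf0 ht ht0
  · have hmaps : MapsTo (fun s : ℝ => -s) (Neg.neg ⁻¹' J) J := fun s hs => hs
    have := linear_ode_eq_zero_of_nonneg (J := Neg.neg ⁻¹' J) (f := fun s => f (-s))
      (g := fun s => -g (-s)) (t := -t) ⟨fun a ha b hb s hs =>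
        hJ.out hb ha ⟨neg_le_neg hs.2, neg_le_neg hs.1⟩⟩ (by simpa using h0)
      ((hg.comp continuous_neg.continuousOn hmaps).neg)
      (fun s hs => by
        have h := (hf (-s) hs).comp s (hasDerivAt_neg s).hasDerivWithinAt hmaps
        exact h.congr_deriv (by ring))
      (by simpa using hf0) (by simpa using ht) (by linarith)
    simpa using this

/-- A function on an interval with vanishing derivative is constant. -/
lemma eq_of_hasDerivWithinAt_zero {J : Set ℝ} (hJ : J.OrdConnected) (h0 : (0 : ℝ) ∈ J)
    {f : ℝ → ℝ} (hf : ∀ t ∈ J, HasDerivWithinAt f 0 J t) {t : ℝ} (ht : t ∈ J) : f t = f 0 :=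
  sub_eq_zero.1 <| linear_ode_eq_zero (f := fun s => f s - f 0) (g := 0) hJ h0
    continuousOn_const (fun s hs => by simpa using (hf s hs).sub_const (f 0)) (by simp) ht

lemma Solves.hasDerivWithinAt_fst {n : ℕ} {ω a : Fin n → ℝ} {ν : ℝ} {x : ℝ → State n}
    {J : Set ℝ} (hx : Solves (eulerField ω a ν) x J) {t : ℝ} (ht : t ∈ J) (i : Fin n) :
    HasDerivWithinAt (fun s => (x s).1 i)
      (-(ω i) * (x t).2 i + (ν + quad a (x t)) * (x t).1 i) J t :=
  hasDerivWithinAt_pi.1 ((ContinuousLinearMap.fst ℝ (Fin n → ℝ)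
    (Fin n → ℝ)).hasFDerivAt.comp_hasDerivWithinAt t (hx t ht)) i

lemma Solves.hasDerivWithinAt_snd {n : ℕ} {ω a : Fin n → ℝ} {ν : ℝ} {x : ℝ → State n}
    {J : Set ℝ} (hx : Solves (eulerField ω a ν) x J) {t : ℝ} (ht : t ∈ J) (i : Fin n) :
    HasDerivWithinAt (fun s => (x s).2 i)
      (ω i * (x t).1 i + (ν + quad a (x t)) * (x t).2 i) J t :=
  hasDerivWithinAt_pi.1 ((ContinuousLinearMap.snd ℝ (Fin n → ℝ)
    (Fin n → ℝ)).hasFDerivAt.comp_hasDerivWithinAt t (hx t ht)) i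

/-- Along a solution every weighted quadratic form satisfies `q' = 2 g q` with the common factor
`g = ν + ∑ a_j ρ_j²`; the rotations do not contribute. -/
lemma Solves.hasDerivWithinAt_quad {n : ℕ} {ω a : Fin n → ℝ} {ν : ℝ} {x : ℝ → State n}
    {J : Set ℝ} (hx : Solves (eulerField ω a ν) x J) (b : Fin n → ℝ) {t : ℝ} (ht : t ∈ J) :
    HasDerivWithinAt (fun s => quad b (x s)) (2 * (ν + quad a (x t)) * quad b (x t)) J t := by
  have h : HasDerivWithinAt (fun s => quad b (x s)) _ J t :=
    HasDerivWithinAt.fun_sum fun j _ =>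
    (((hx.hasDerivWithinAt_fst ht j).pow 2).add ((hx.hasDerivWithinAt_snd ht j).pow 2)).const_mul
      (b j)
  refine h.congr_deriv ?_
  conv_rhs => rw [quad.eq_def b]
  rw [Finset.mul_sum]
  refine Finset.sum_congr rfl fun i _ => ?_
  push_cast
  ring

lemma Solves.continuousOn {n : ℕ} {ω a : Fin n → ℝ} {ν : ℝ} {x : ℝ → State n}
    {J : Set ℝ} (hx : Solves (eulerField ω a ν) x J) : ContinuousOn x J :=
  fun t ht => (hx t ht).continuousWithinAt

lemma quad_one_nonneg {n : ℕ} (p : State n) : 0 ≤ quad 1 p :=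
  Finset.sum_nonneg fun i _ => by simp only [Pi.one_apply]; positivity

lemma quad_one_eq_zero {n : ℕ} {p : State n} : quad 1 p = 0 ↔ p = 0 := by
  constructor
  · intro h
    rw [quad, Finset.sum_eq_zero_iff_of_nonneg
      (fun i _ => by simp only [Pi.one_apply]; positivity)] at h
    have h' : ∀ i, p.1 i = 0 ∧ p.2 i = 0 := fun i => by
      have := h i (Finset.mem_univ i)
      simp only [Pi.one_apply, one_mul] at this
      constructor <;> nlinarith [sq_nonneg (p.1 i), sq_nonneg (p.2 i)]
    exact Prod.ext (funext fun i => (h' i).1) (funext fun i => (h' i).2)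
  · rintro rfl
    simp [quad]

lemma quad_one_pos {n : ℕ} {p : State n} (hp : p ≠ 0) : 0 < quad 1 p :=
  lt_of_le_of_ne (quad_one_nonneg p) fun h => hp (quad_one_eq_zero.1 h.symm)

lemma hasDerivWithinAt_cos_mul (c : ℝ) (J : Set ℝ) (t : ℝ) :
    HasDerivWithinAt (fun r => Real.cos (c * r)) (-Real.sin (c * t) * c) J t := by
  simpa using (((hasDerivAt_id t).const_mul c).cos).hasDerivWithinAt

lemma hasDerivWithinAt_sin_mul (c : ℝ) (J : Set ℝ) (t : ℝ) :
    HasDerivWithinAt (fun r => Real.sin (c * r)) (Real.cos (c * t) * c) J t := by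
  simpa using (((hasDerivAt_id t).const_mul c).sin).hasDerivWithinAt

/-- The reciprocal scaling `w = ‖p‖² / ‖x‖²` of a solution through `p` satisfies the linear equation
`w' = -2 ν w - 2 ∑ a_j ρ_j(p)²`, which linearizes the radial dynamics. -/
structure IsScaling {n : ℕ} (a : Fin n → ℝ) (ν : ℝ) (p : State n) (w : ℝ → ℝ) : Prop where
  deriv : ∀ t, HasDerivAt w (-2 * ν * w t - 2 * quad a p) t
  zero : w 0 = 1

/-- Every solution is a scaled rotation of its initial point, `x(t) = w(t)^{-1/2} R_{ωt} p`. -/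
lemma Solves.eq_spiral {n : ℕ} {ω a : Fin n → ℝ} {ν : ℝ} {x : ℝ → State n}
    {J : Set ℝ} (hJ : J.OrdConnected) (h0 : (0 : ℝ) ∈ J) (hx : Solves (eulerField ω a ν) x J)
    (hp : x 0 ≠ 0) {w : ℝ → ℝ} (hw : IsScaling a ν (x 0) w) {t : ℝ} (ht : t ∈ J) :
    0 < w t ∧ x t = spiral ω (√(w t))⁻¹ t (x 0) := by
  have hcq : ∀ b, ContinuousOn (fun s => quad b (x s)) J := fun b =>
    (continuous_quad b).comp_continuousOn hx.continuousOn
  have hwc : Continuous w := continuous_iff_continuousAt.2 fun s => (hw.deriv s).continuousAt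
  -- `w * q` is conserved for the form `q` with weights `a`, and then for all weights
  have hP : ∀ s ∈ J, w s * quad a (x s) = quad a (x 0) := fun s hs => by
    have := linear_ode_eq_zero (f := fun s => w s * quad a (x s) - quad a (x 0))
      (g := fun s => 2 * quad a (x s)) hJ h0 (continuousOn_const.mul (hcq a))
      (fun r hr => ((((hw.deriv r).hasDerivWithinAt).mul
        (hx.hasDerivWithinAt_quad a hr)).sub_const _).congr_deriv (by ring))
      (by simp [hw.zero]) hs
    linarith
  have hN : ∀ s ∈ J, w s * quad 1 (x s) = quad 1 (x 0) := fun s hs => by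
    have := eq_of_hasDerivWithinAt_zero (f := fun s => w s * quad 1 (x s)) hJ h0
      (fun r hr => (((hw.deriv r).hasDerivWithinAt).mul
        (hx.hasDerivWithinAt_quad 1 hr)).congr_deriv (by
          linear_combination (2 * quad 1 (x r)) * hP r hr)) hs
    simpa [hw.zero] using this
  have hN0 := quad_one_pos hp
  have hpos : ∀ s ∈ J, 0 < w s := fun s hs => by
    by_contra! hle
    have := mul_nonneg_of_nonpos_of_nonpos hle (neg_nonpos.2 (quad_one_nonneg (x s)))
    linarith [hN s hs]
  have hsq : ∀ s ∈ J, HasDerivWithinAt (fun r => √(w r)) (-(ν + quad a (x s)) * √(w s)) J s :=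
    fun s hs => ((hw.deriv s).hasDerivWithinAt.sqrt (hpos s hs).ne').congr_deriv (by
      have h1 := Real.sqrt_pos.2 (hpos s hs)
      have h2 := Real.sq_sqrt (hpos s hs).le
      rw [div_eq_iff (by positivity)]
      linear_combination (2 * ν + 2 * quad a (x s)) * h2 + 2 * hP s hs)
  have hcos := fun (i : Fin n) (s : ℝ) => hasDerivWithinAt_cos_mul (ω i) J s
  have hsin := fun (i : Fin n) (s : ℝ) => hasDerivWithinAt_sin_mul (ω i) J s
  -- in corotating coordinates, rescaled by `√w`, the solution is constant
  have h1 : ∀ i, √(w t) * (Real.cos (ω i * t) * (x t).1 i + Real.sin (ω i * t) * (x t).2 i) =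
      (x 0).1 i := fun i => by
    have := eq_of_hasDerivWithinAt_zero (f := fun s => √(w s) *
      (Real.cos (ω i * s) * (x s).1 i + Real.sin (ω i * s) * (x s).2 i)) hJ h0
      (fun s hs => ((hsq s hs).mul (((hcos i s).mul (hx.hasDerivWithinAt_fst hs i)).add
        ((hsin i s).mul (hx.hasDerivWithinAt_snd hs i)))).congr_deriv (by
          simp only [Pi.add_apply, Pi.mul_apply]; ring)) ht
    simpa [hw.zero] using this
  have h2 : ∀ i, √(w t) * (-Real.sin (ω i * t) * (x t).1 i + Real.cos (ω i * t) * (x t).2 i) =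
      (x 0).2 i := fun i => by
    have := eq_of_hasDerivWithinAt_zero (f := fun s => √(w s) *
      (-Real.sin (ω i * s) * (x s).1 i + Real.cos (ω i * s) * (x s).2 i)) hJ h0
      (fun s hs => ((hsq s hs).mul (((hsin i s).neg.mul (hx.hasDerivWithinAt_fst hs i)).add
        ((hcos i s).mul (hx.hasDerivWithinAt_snd hs i)))).congr_deriv (by
          simp only [Pi.add_apply, Pi.mul_apply, Pi.neg_apply]; ring)) ht
    simpa [hw.zero] using this
  refine ⟨hpos t ht, ?_⟩
  have hs0 := (Real.sqrt_pos.2 (hpos t ht)).ne'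
  refine Prod.ext (funext fun i => ?_) (funext fun i => ?_)
  · simp only [spiral]
    rw [← h1 i, ← h2 i, eq_inv_mul_iff_mul_eq₀ hs0]
    linear_combination -√(w t) * (x t).1 i * Real.cos_sq_add_sin_sq (ω i * t)
  · simp only [spiral]
    rw [← h1 i, ← h2 i, eq_inv_mul_iff_mul_eq₀ hs0]
    linear_combination -√(w t) * (x t).2 i * Real.cos_sq_add_sin_sq (ω i * t)

/-- Conversely, the scaled rotations are solutions for as long as the scaling is positive. -/
lemma IsScaling.solves {n : ℕ} {ω a : Fin n → ℝ} {ν : ℝ} {p : State n} {w : ℝ → ℝ}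
    (hw : IsScaling a ν p w) {J : Set ℝ} (hpos : ∀ t ∈ J, 0 < w t) :
    Solves (eulerField ω a ν) (fun t => spiral ω (√(w t))⁻¹ t p) J := by
  intro t ht
  have hs0 := Real.sqrt_pos.2 (hpos t ht)
  have hsq := Real.sq_sqrt (hpos t ht).le
  have hq : quad a (spiral ω (√(w t))⁻¹ t p) = (w t)⁻¹ * quad a p := by
    rw [quad_spiral, inv_pow, hsq]
  have hd : HasDerivWithinAt (fun r => (√(w r))⁻¹)
      ((ν + (w t)⁻¹ * quad a p) * (√(w t))⁻¹) J t :=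
    (((hw.deriv t).hasDerivWithinAt.sqrt (hpos t ht).ne').inv hs0.ne').congr_deriv (by
      rw [hsq]
      have := (hpos t ht).ne'
      field_simp
      ring)
  have hcos := fun i : Fin n => hasDerivWithinAt_cos_mul (ω i) J t
  have hsin := fun i : Fin n => hasDerivWithinAt_sin_mul (ω i) J t
  have hsum : ∑ j, a j * ((spiral ω (√(w t))⁻¹ t p).1 j ^ 2 +
      (spiral ω (√(w t))⁻¹ t p).2 j ^ 2) = (w t)⁻¹ * quad a p := hq
  refine HasDerivWithinAt.congr_deriv (HasDerivWithinAt.prodMk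
    (hasDerivWithinAt_pi.2 fun i => hd.mul
      (((hcos i).mul_const (p.1 i)).sub ((hsin i).mul_const (p.2 i))))
    (hasDerivWithinAt_pi.2 fun i => hd.mul
      (((hsin i).mul_const (p.1 i)).add ((hcos i).mul_const (p.2 i))))) ?_
  refine Prod.ext (funext fun i => ?_) (funext fun i => ?_)
  · simp only [eulerField, hsum]
    simp only [spiral]
    ring
  · simp only [eulerField, hsum]
    simp only [spiral]
    ring

lemma spiral_one_zero {n : ℕ} (ω : Fin n → ℝ) (p : State n) : spiral ω 1 0 p = p := by
  simp [spiral]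

lemma IsScaling.spiral_zero {n : ℕ} {ω a : Fin n → ℝ} {ν : ℝ} {p : State n} {w : ℝ → ℝ}
    (hw : IsScaling a ν p w) : spiral ω (√(w 0))⁻¹ 0 p = p := by
  simp [hw.zero, spiral_one_zero]

/-- For `ν ≠ 0` the scaling is `E + y (1 - E)` with `y = -(∑ a_j ρ_j(p)²) / ν` and `E = exp (-2νt)`;
the point `p` lies on the invariant set `ν + ∑ a_j ρ_j² = 0` exactly if `y = 1`. -/
def scaling {n : ℕ} (a : Fin n → ℝ) (ν : ℝ) (p : State n) (t : ℝ) : ℝ :=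
  Real.exp (-2 * ν * t) + -quad a p / ν * (1 - Real.exp (-2 * ν * t))

lemma isScaling_scaling {n : ℕ} (a : Fin n → ℝ) {ν : ℝ} (hν : ν ≠ 0) (p : State n) :
    IsScaling a ν p (scaling a ν p) := by
  refine ⟨fun t => ?_, by simp [scaling]⟩
  have h : HasDerivAt (fun t => Real.exp (-2 * ν * t)) (Real.exp (-2 * ν * t) * (-2 * ν)) t := by
    simpa using ((hasDerivAt_id t).const_mul (-2 * ν)).exp
  exact (h.add ((h.const_sub 1).const_mul (-quad a p / ν))).congr_deriv
    (by rw [scaling]; field_simp; ring)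

/-- For `ν = 0` the scaling is affine in time. -/
lemma isScaling_zero {n : ℕ} (a : Fin n → ℝ) (p : State n) :
    IsScaling a 0 p fun t => 1 - 2 * quad a p * t :=
  ⟨fun t => (((hasDerivAt_id t).const_mul (2 * quad a p)).const_sub 1).congr_deriv (by simp),
    by simp⟩

lemma exists_isScaling {n : ℕ} (a : Fin n → ℝ) (ν : ℝ) (p : State n) :
    ∃ w, IsScaling a ν p w := by
  rcases eq_or_ne ν 0 with rfl | hν
  · exact ⟨_, isScaling_zero a p⟩
  · exact ⟨_, isScaling_scaling a hν p⟩

/-- A solution starting at the origin stays there. -/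
lemma Solves.eq_zero {n : ℕ} {ω a : Fin n → ℝ} {ν : ℝ} {x : ℝ → State n}
    {J : Set ℝ} (hJ : J.OrdConnected) (h0 : (0 : ℝ) ∈ J) (hx : Solves (eulerField ω a ν) x J)
    (hp : x 0 = 0) {t : ℝ} (ht : t ∈ J) : x t = 0 :=
  quad_one_eq_zero.1 <| linear_ode_eq_zero (f := fun s => quad 1 (x s))
    (g := fun s => 2 * (ν + quad a (x s))) hJ h0
    (continuousOn_const.mul (continuousOn_const.add
      ((continuous_quad a).comp_continuousOn hx.continuousOn)))
    (fun _ hs => hx.hasDerivWithinAt_quad 1 hs) (by simp [hp, quad]) ht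

/-- Every point of a solution is a positively scaled rotation of the initial point. -/
lemma Solves.exists_eq_spiral {n : ℕ} {ω a : Fin n → ℝ} {ν : ℝ} {x : ℝ → State n}
    {J : Set ℝ} (hJ : J.OrdConnected) (h0 : (0 : ℝ) ∈ J) (hx : Solves (eulerField ω a ν) x J)
    {t : ℝ} (ht : t ∈ J) : ∃ lam : ℝ, 0 < lam ∧ x t = spiral ω lam t (x 0) := by
  by_cases hp : x 0 = 0
  · exact ⟨1, one_pos, by rw [hx.eq_zero hJ h0 hp ht, hp]; ext <;> simp [spiral]⟩
  · obtain ⟨w, hw⟩ := exists_isScaling a ν (x 0)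
    obtain ⟨h1, h2⟩ := hx.eq_spiral hJ h0 hp hw ht
    exact ⟨_, inv_pos.2 (Real.sqrt_pos.2 h1), h2⟩

/-- Through every point there is a solution on a neighbourhood of time `0`. -/
lemma exists_local_solution {n : ℕ} (ω a : Fin n → ℝ) (ν : ℝ) (p : State n) :
    ∃ ε > 0, ∃ x : ℝ → State n, Solves (eulerField ω a ν) x (Ioo (-ε) ε) ∧ x 0 = p := by
  obtain ⟨w, hw⟩ := exists_isScaling a ν p
  have : ∀ᶠ t in 𝓝 (0 : ℝ), 0 < w t :=
    (hw.deriv 0).continuousAt.eventually (by rw [hw.zero]; exact lt_mem_nhds one_pos)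
  obtain ⟨ε, hε, h⟩ := Metric.eventually_nhds_iff_ball.1 this
  refine ⟨ε, hε, _, hw.solves fun t ht => h t ?_, hw.spiral_zero⟩
  rwa [Real.ball_eq_Ioo, zero_sub, zero_add]

/-! ### Coordinate faces of the positive spherical simplex -/

/-- Unit vectors whose coordinates in `A` are positive and whose other coordinates vanish. -/
def openFace {n : ℕ} (A : Finset (Fin n)) : Set (Fin n → ℝ) :=
  {c | (∀ i ∈ A, 0 < c i) ∧ (∀ i ∉ A, c i = 0) ∧ ∑ i, c i ^ 2 = 1}

/-- Unit vectors with nonnegative coordinates that vanish outside `A`. -/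
def closedFace {n : ℕ} (A : Finset (Fin n)) : Set (Fin n → ℝ) :=
  {c | (∀ i, 0 ≤ c i) ∧ (∀ i ∉ A, c i = 0) ∧ ∑ i, c i ^ 2 = 1}

/-- The set `{γ(1), …, γ(l)}` of the first `l` values of a permutation. -/
def initialValues {n : ℕ} (l : ℕ) (γ : Equiv.Perm (Fin n)) : Finset (Fin n) :=
  Finset.univ.filter fun m => (γ.symm m).val < l

lemma mem_initialValues {n l : ℕ} {γ : Equiv.Perm (Fin n)} {m : Fin n} :
    m ∈ initialValues l γ ↔ (γ.symm m).val < l := by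
  simp [initialValues]

lemma apply_mem_initialValues {n l : ℕ} {γ : Equiv.Perm (Fin n)} {i : Fin n} :
    γ i ∈ initialValues l γ ↔ i.val < l := by
  simp [initialValues]

lemma spherePos_eq {n l : ℕ} (γ : Equiv.Perm (Fin n)) :
    spherePos n l γ = openFace (initialValues l γ) := by
  ext c
  simp only [spherePos, openFace, mem_ofPred_eq, mem_initialValues, not_lt]
  refine and_congr (γ.forall_congr fun {i} => ?_) (and_congr (γ.forall_congr fun {i} => ?_) Iff.rfl)
  · simp
  · simp

lemma card_initialValues {n l : ℕ} (hl : l ≤ n) (γ : Equiv.Perm (Fin n)) :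
    (initialValues l γ).card = l := by
  have : initialValues l γ = (Finset.univ.filter fun i : Fin n => i.val < l).map γ.toEmbedding := by
    ext m
    simp [initialValues, Finset.mem_map_equiv]
  rw [this, Finset.card_map, Fin.card_filter_val_lt, min_eq_right hl]

/-- `γ ∈ S^{l,σ}_n` says that the first `l` values of `γ` are among the first `k` values of `σ`. -/
lemma initialValues_subset {n k l : ℕ} {σ γ : Equiv.Perm (Fin n)}
    (h : γ ∈ subShuffles n k σ l) : initialValues l γ ⊆ initialValues k σ := by
  intro m hm
  rw [mem_initialValues] at hm ⊢
  by_contra! hlt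
  obtain ⟨j, hj, he⟩ := h.2.2 (σ.symm m) hlt
  rw [Equiv.apply_symm_apply] at he
  rw [← he, Equiv.symm_apply_apply] at hm
  omega

/-- Every set of positions consists of the first values of a shuffle. -/
lemma exists_shuffle {n l : ℕ} (A : Finset (Fin n)) (hA : A.card = l) :
    ∃ γ ∈ shuffles n l, initialValues l γ = A := by
  have hl : l ≤ n := by simpa [hA] using Finset.card_le_univ A
  have hc : Aᶜ.card = n - l := by rw [Finset.card_compl, hA, Fintype.card_fin]
  let γ : Equiv.Perm (Fin n) := (finCongr (by omega : n = l + (n - l))).trans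
    (finSumFinEquiv.symm.trans (finSumEquivOfFinset hA hc))
  have h1 : ∀ i : Fin n, ∀ hi : i.val < l, γ i = A.orderEmbOfFin hA ⟨i.val, hi⟩ := by
    intro i hi
    have : finCongr (by omega : n = l + (n - l)) i = Fin.castAdd (n - l) ⟨i.val, hi⟩ := rfl
    simp only [γ, Equiv.trans_apply, this, finSumFinEquiv_symm_apply_castAdd,
      finSumEquivOfFinset_inl]
  have h2 : ∀ i : Fin n, ∀ hi : l ≤ i.val,
      γ i = Aᶜ.orderEmbOfFin hc ⟨i.val - l, by omega⟩ := by
    intro i hi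
    have : finCongr (by omega : n = l + (n - l)) i = Fin.natAdd l ⟨i.val - l, by omega⟩ :=
      Fin.ext (by simp; omega)
    simp only [γ, Equiv.trans_apply, this, finSumFinEquiv_symm_apply_natAdd,
      finSumEquivOfFinset_inr]
  refine ⟨γ, fun i j hij h => ?_, ?_⟩
  · rcases h with h | h
    · rw [h1 i (lt_trans hij h), h1 j h]
      exact (A.orderEmbOfFin hA).strictMono hij
    · rw [h2 i h, h2 j (h.trans (le_of_lt hij))]
      refine (Aᶜ.orderEmbOfFin hc).strictMono ?_
      have : i.val < j.val := hij
      simp only [Fin.mk_lt_mk]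
      omega
  · refine Finset.eq_of_subset_of_card_le (fun m hm => ?_) (by rw [card_initialValues hl, hA])
    obtain ⟨i, rfl⟩ := γ.surjective m
    rw [apply_mem_initialValues] at hm
    rw [h1 i hm]
    exact A.orderEmbOfFin_mem hA _

/-- Every subset of the first `k` values of `σ` consists of the first values of some
`γ ∈ S^{l,σ}_n`. -/
lemma exists_subShuffle {n k l : ℕ} (hkn : k ≤ n) {σ : Equiv.Perm (Fin n)} {A : Finset (Fin n)}
    (hA : A.card = l) (hAS : A ⊆ initialValues k σ) :
    ∃ γ ∈ subShuffles n k σ l, initialValues l γ = A := by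
  obtain ⟨γ, hγ, hγA⟩ := exists_shuffle A hA
  refine ⟨γ, ⟨hγ, ?_, fun i hi => ⟨γ.symm (σ i), ?_, by simp⟩⟩, hγA⟩
  · simpa [hA, card_initialValues hkn] using Finset.card_le_card hAS
  · by_contra! hlt
    have : σ i ∈ A := by rw [← hγA, mem_initialValues]; exact hlt
    have := hAS this
    rw [apply_mem_initialValues] at this
    omega

lemma openFace_subset_closedFace {n : ℕ} {A B : Finset (Fin n)} (h : A ⊆ B) :
    openFace A ⊆ closedFace B := fun _ hc =>
  ⟨fun i => if hi : i ∈ A then (hc.1 i hi).le else (hc.2.1 i hi).ge,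
    fun i hi => hc.2.1 i fun hA => hi (h hA), hc.2.2⟩

lemma closedFace_mono {n : ℕ} {A B : Finset (Fin n)} (h : A ⊆ B) :
    closedFace A ⊆ closedFace B := fun _ hc =>
  ⟨hc.1, fun i hi => hc.2.1 i fun hA => hi (h hA), hc.2.2⟩

/-- The support of a vector. -/
def supp {n : ℕ} (c : Fin n → ℝ) : Finset (Fin n) := Finset.univ.filter fun i => c i ≠ 0

lemma mem_supp {n : ℕ} {c : Fin n → ℝ} {i : Fin n} : i ∈ supp c ↔ c i ≠ 0 := by simp [supp]

lemma supp_eq_of_mem_openFace {n : ℕ} {A : Finset (Fin n)} {c : Fin n → ℝ}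
    (hc : c ∈ openFace A) : supp c = A := by
  ext i
  rw [mem_supp]
  exact ⟨fun h => by_contra fun hi => h (hc.2.1 i hi), fun hi => (hc.1 i hi).ne'⟩

lemma mem_openFace_iff {n : ℕ} {A : Finset (Fin n)} {c : Fin n → ℝ} :
    c ∈ openFace A ↔ c ∈ closedFace A ∧ supp c = A := by
  refine ⟨fun h => ⟨openFace_subset_closedFace subset_rfl h, supp_eq_of_mem_openFace h⟩, ?_⟩
  rintro ⟨h, rfl⟩
  exact ⟨fun i hi => lt_of_le_of_ne (h.1 i) (mem_supp.1 hi).symm, h.2⟩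

lemma mem_openFace_supp {n : ℕ} {A : Finset (Fin n)} {c : Fin n → ℝ} (hc : c ∈ closedFace A) :
    c ∈ openFace (supp c) :=
  ⟨fun i hi => lt_of_le_of_ne (hc.1 i) (mem_supp.1 hi).symm,
    fun i hi => by simpa [mem_supp] using hi, hc.2.2⟩

lemma supp_subset {n : ℕ} {A : Finset (Fin n)} {c : Fin n → ℝ} (hc : c ∈ closedFace A) :
    supp c ⊆ A := fun i hi => by_contra fun hA => mem_supp.1 hi (hc.2.1 i hA)

lemma supp_nonempty {n : ℕ} {A : Finset (Fin n)} {c : Fin n → ℝ} (hc : c ∈ closedFace A) :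
    (supp c).Nonempty := by
  by_contra! h
  have : ∀ i, c i = 0 := fun i => by
    by_contra hi
    exact Finset.notMem_empty i (h ▸ mem_supp.2 hi)
  have h1 := hc.2.2
  simp [this] at h1

lemma openFace_nonempty {n : ℕ} {A : Finset (Fin n)} (hA : A.Nonempty) : (openFace A).Nonempty := by
  have hc : (0 : ℝ) < A.card := by exact_mod_cast hA.card_pos
  refine ⟨fun i => if i ∈ A then √((A.card : ℝ)⁻¹) else 0, fun i hi => ?_, fun i hi => ?_, ?_⟩
  · simp only [hi, if_true]
    positivity
  · simp [hi]
  · have : ∀ i : Fin n, (if i ∈ A then √((A.card : ℝ)⁻¹) else 0) ^ 2 =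
        if i ∈ A then (A.card : ℝ)⁻¹ else 0 := fun i => by
      split_ifs
      · exact Real.sq_sqrt (by positivity)
      · simp
    simp only [this, Finset.sum_ite_mem, Finset.univ_inter, Finset.sum_const, nsmul_eq_mul]
    exact mul_inv_cancel₀ hc.ne'

lemma openFace_subset_closedFace_iff {n : ℕ} {A B : Finset (Fin n)} (hA : A.Nonempty) :
    openFace A ⊆ closedFace B ↔ A ⊆ B := by
  refine ⟨fun h => ?_, openFace_subset_closedFace⟩
  obtain ⟨c, hc⟩ := openFace_nonempty hA
  rw [← supp_eq_of_mem_openFace hc]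
  exact supp_subset (h hc)

lemma openFace_injective {n : ℕ} {A B : Finset (Fin n)} (hA : A.Nonempty)
    (h : openFace A = openFace B) : A = B := by
  obtain ⟨c, hc⟩ := openFace_nonempty hA
  exact (supp_eq_of_mem_openFace hc).symm.trans (supp_eq_of_mem_openFace (h ▸ hc))

lemma isClosed_closedFace {n : ℕ} (A : Finset (Fin n)) : IsClosed (closedFace A) := by
  refine IsClosed.and (?_ : IsClosed {c : Fin n → ℝ | _})
    (IsClosed.and (?_ : IsClosed {c : Fin n → ℝ | _}) ?_)
  · simp only [ofPred_forall]
    exact isClosed_iInter fun i => isClosed_le continuous_const (continuous_apply i)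
  · simp only [ofPred_forall]
    exact isClosed_iInter fun i => isClosed_iInter fun _ =>
      isClosed_eq (continuous_apply i) continuous_const
  · exact isClosed_eq (by fun_prop) continuous_const

lemma isCompact_closedFace {n : ℕ} (A : Finset (Fin n)) : IsCompact (closedFace A) := by
  refine Metric.isCompact_of_isClosed_isBounded (isClosed_closedFace A)
    ((isBounded_closedBall (x := (0 : Fin n → ℝ)) (r := 1)).subset fun c hc => ?_)
  rw [mem_closedBall_zero_iff, pi_norm_le_iff_of_nonneg zero_le_one]
  intro i
  have := Finset.single_le_sum (f := fun i => c i ^ 2) (fun i _ => sq_nonneg _) (Finset.mem_univ i)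
  rw [hc.2.2] at this
  exact (sq_le_one_iff_abs_le_one _).1 this

/-- The closure of an open face is the closed face: a point `c` is the limit of the points with
squared coordinates `(1 - ε) c_i² + ε / #A`. -/
lemma closure_openFace {n : ℕ} {A : Finset (Fin n)} (hA : A.Nonempty) :
    closure (openFace A) = closedFace A := by
  refine Subset.antisymm
    (closure_minimal (openFace_subset_closedFace subset_rfl) (isClosed_closedFace A)) ?_
  intro c hc
  obtain ⟨d, hd⟩ := openFace_nonempty hA
  have hcont : Continuous fun (ε : ℝ) (i : Fin n) => √((1 - ε) * c i ^ 2 + ε * d i ^ 2) := by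
    fun_prop
  have hlim : Tendsto (fun (ε : ℝ) (i : Fin n) => √((1 - ε) * c i ^ 2 + ε * d i ^ 2))
      (𝓝[>] 0) (𝓝 c) := by
    convert (hcont.tendsto 0).mono_left nhdsWithin_le_nhds using 2
    ext i
    simp [Real.sqrt_sq (hc.1 i)]
  refine mem_closure_of_tendsto hlim ?_
  filter_upwards [Ioo_mem_nhdsGT one_pos] with ε hε
  have h1 : 0 < 1 - ε := by linarith [hε.2]
  have h0 : 0 < ε := hε.1
  have hnn : ∀ i, 0 ≤ (1 - ε) * c i ^ 2 + ε * d i ^ 2 := fun i => by positivity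
  refine ⟨fun i hi => ?_, fun i hi => ?_, ?_⟩
  · have := hd.1 i hi
    exact Real.sqrt_pos.2 (by positivity)
  · simp [hc.2.1 i hi, hd.2.1 i hi]
  · simp only [Real.sq_sqrt (hnn _), Finset.sum_add_distrib, ← Finset.mul_sum, hc.2.2, hd.2.2]
    ring

/-! ### Characteristic maps of the faces -/

/-- The cube is homeomorphic to the solid simplex. -/
lemma exists_homeomorph_simplex (l : ℕ) : ∃ h : (Fin l → ℝ) ≃ₜ (Fin l → ℝ),
    h '' {y | (∀ j, 0 < y j) ∧ ∑ j, y j < 1} = ball 0 1 ∧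
      h '' {y | (∀ j, 0 ≤ y j) ∧ ∑ j, y j ≤ 1} = closedBall 0 1 := by
  set s : Set (Fin l → ℝ) := {y | (∀ j, 0 < y j) ∧ ∑ j, y j < 1} with hs
  have hopen : IsOpen s := by
    refine IsOpen.and (?_ : IsOpen {y : Fin l → ℝ | _}) ?_
    · simp only [ofPred_forall]
      exact isOpen_iInter_of_finite fun j => isOpen_lt continuous_const (continuous_apply j)
    · exact isOpen_lt (by fun_prop) continuous_const
  have hclosed : IsClosed {y : Fin l → ℝ | (∀ j, 0 ≤ y j) ∧ ∑ j, y j ≤ 1} := by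
    refine IsClosed.and (?_ : IsClosed {y : Fin l → ℝ | _}) ?_
    · simp only [ofPred_forall]
      exact isClosed_iInter fun j => isClosed_le continuous_const (continuous_apply j)
    · exact isClosed_le (by fun_prop) continuous_const
  have hconv : Convex ℝ s := by
    intro x hx y hy α β hα hβ hαβ
    refine ⟨fun j => ?_, ?_⟩
    · have h1 := hx.1 j
      have h2 := hy.1 j
      simp only [Pi.add_apply, Pi.smul_apply, smul_eq_mul]
      rcases hα.eq_or_lt with rfl | hα
      · have : β = 1 := by linarith
        subst this
        simpa using h2
      · have := mul_pos hα h1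
        have := mul_nonneg hβ h2.le
        linarith
    · simp only [Pi.add_apply, Pi.smul_apply, smul_eq_mul, Finset.sum_add_distrib,
        ← Finset.mul_sum]
      have h1 := hx.2
      have h2 := hy.2
      rcases hα.eq_or_lt with rfl | hα
      · have : β = 1 := by linarith
        subst this
        simpa using h2
      · nlinarith [mul_lt_mul_of_pos_left h1 hα, mul_le_mul_of_nonneg_left h2.le hβ]
  -- the centre of the simplex
  have hb : (fun _ => ((l : ℝ) + 1)⁻¹ : Fin l → ℝ) ∈ s := by
    refine ⟨fun j => by positivity, ?_⟩
    simp only [Finset.sum_const, Finset.card_univ, Fintype.card_fin, nsmul_eq_mul]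
    rw [← div_eq_mul_inv, div_lt_one (by positivity)]
    linarith
  have hcl : closure s = {y | (∀ j, 0 ≤ y j) ∧ ∑ j, y j ≤ 1} := by
    refine Subset.antisymm (closure_minimal (fun y hy => ⟨fun j => (hy.1 j).le, hy.2.le⟩) hclosed) ?_
    intro y hy
    have hlim : Tendsto (fun ε : ℝ => (1 - ε) • y + ε • (fun _ => ((l : ℝ) + 1)⁻¹ : Fin l → ℝ))
        (𝓝[>] 0) (𝓝 y) := by
      have hc : Continuous fun ε : ℝ => (1 - ε) • y + ε • (fun _ => ((l : ℝ) + 1)⁻¹ : Fin l → ℝ) := by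
        fun_prop
      simpa using (hc.tendsto 0).mono_left nhdsWithin_le_nhds
    refine mem_closure_of_tendsto hlim ?_
    filter_upwards [Ioo_mem_nhdsGT one_pos] with ε hε
    have h1 : 0 < 1 - ε := by linarith [hε.2]
    have h0 : 0 < ε := hε.1
    refine ⟨fun j => ?_, ?_⟩
    · have := mul_nonneg h1.le (hy.1 j)
      have := mul_pos h0 (hb.1 j)
      simp only [Pi.add_apply, Pi.smul_apply, smul_eq_mul]
      linarith
    · have h2 := hy.2
      have h3 := mul_lt_mul_of_pos_left hb.2 h0
      simp only [Pi.add_apply, Pi.smul_apply, smul_eq_mul, Finset.sum_add_distrib,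
        ← Finset.mul_sum]
      nlinarith
  have hbdd : Bornology.IsBounded s := by
    refine (isBounded_closedBall (x := (0 : Fin l → ℝ)) (r := 1)).subset fun y hy => ?_
    rw [mem_closedBall_zero_iff, pi_norm_le_iff_of_nonneg zero_le_one]
    intro j
    rw [Real.norm_of_nonneg (hy.1 j).le]
    exact (Finset.single_le_sum (fun i _ => (hy.1 i).le) (Finset.mem_univ j)).trans hy.2.le
  obtain ⟨h, h1, h2, -⟩ := exists_homeomorph_image_interior_closure_frontier_eq_unitBall hconv
    (by rw [hopen.interior_eq]; exact ⟨_, hb⟩) hbdd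
  rw [hopen.interior_eq] at h1
  rw [hcl] at h2
  exact ⟨h, h1, h2⟩

/-- Barycentric coordinates of a point of the solid simplex. -/
def baryCoord {l : ℕ} (y : Fin l → ℝ) : Fin (l + 1) → ℝ := Fin.cons (1 - ∑ j, y j) y

lemma sum_baryCoord {l : ℕ} (y : Fin l → ℝ) : ∑ j, baryCoord y j = 1 := by
  simp [baryCoord, Fin.sum_univ_succ]

lemma continuous_baryCoord {l : ℕ} (j : Fin (l + 1)) :
    Continuous fun y : Fin l → ℝ => baryCoord y j := by
  refine Fin.cases ?_ (fun i => ?_) j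
  · simp only [baryCoord, Fin.cons_zero]
    fun_prop
  · simp only [baryCoord, Fin.cons_succ]
    fun_prop

/-- The face with labels `A`, parametrized by the solid simplex: the squares of the coordinates in
`A` are the barycentric coordinates. -/
def faceParam {n l : ℕ} (A : Finset (Fin n)) (hA : A.card = l + 1) (y : Fin l → ℝ) : Fin n → ℝ :=
  fun m => if hm : m ∈ A then √(baryCoord y ((A.orderIsoOfFin hA).symm ⟨m, hm⟩)) else 0

lemma faceParam_emb {n l : ℕ} (A : Finset (Fin n)) (hA : A.card = l + 1) (y : Fin l → ℝ)
    (j : Fin (l + 1)) : faceParam A hA y (A.orderEmbOfFin hA j) = √(baryCoord y j) := by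
  have : (A.orderIsoOfFin hA).symm ⟨A.orderEmbOfFin hA j, A.orderEmbOfFin_mem hA j⟩ = j := by
    rw [OrderIso.symm_apply_eq]
    rfl
  rw [faceParam, dif_pos (A.orderEmbOfFin_mem hA j), this]

lemma continuous_faceParam {n l : ℕ} (A : Finset (Fin n)) (hA : A.card = l + 1) :
    Continuous (faceParam A hA) := by
  refine continuous_pi fun m => ?_
  by_cases hm : m ∈ A
  · simp only [faceParam, hm, dif_pos]
    exact (continuous_baryCoord _).sqrt
  · simp only [faceParam, hm, dif_neg, not_false_eq_true]
    exact continuous_const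

lemma sum_eq_sum_emb {n l : ℕ} {A : Finset (Fin n)} (hA : A.card = l) {f : Fin n → ℝ}
    (hf : ∀ i ∉ A, f i = 0) : ∑ i, f i = ∑ j, f (A.orderEmbOfFin hA j) := by
  rw [← Finset.sum_subset (Finset.subset_univ A) fun i _ hi => hf i hi]
  conv_lhs => rw [← A.map_orderEmbOfFin_univ hA]
  rw [Finset.sum_map]
  rfl

lemma exists_emb {n l : ℕ} {A : Finset (Fin n)} (hA : A.card = l) {i : Fin n} (hi : i ∈ A) :
    ∃ j, A.orderEmbOfFin hA j = i := by
  have : i ∈ (A : Set (Fin n)) := hi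
  rwa [← A.range_orderEmbOfFin hA] at this

/-- The barycentric coordinates, without the first one, of a point of the face. -/
def faceCoord {n l : ℕ} (A : Finset (Fin n)) (hA : A.card = l + 1) (c : Fin n → ℝ) : Fin l → ℝ :=
  fun j => c (A.orderEmbOfFin hA j.succ) ^ 2

lemma baryCoord_faceCoord {n l : ℕ} {A : Finset (Fin n)} (hA : A.card = l + 1) {c : Fin n → ℝ}
    (hc : c ∈ closedFace A) (j : Fin (l + 1)) :
    baryCoord (faceCoord A hA c) j = c (A.orderEmbOfFin hA j) ^ 2 := by
  refine Fin.cases ?_ (fun i => ?_) j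
  · have := sum_eq_sum_emb hA (f := fun i => c i ^ 2) fun i hi => by simp [hc.2.1 i hi]
    rw [hc.2.2, Fin.sum_univ_succ] at this
    simp only [baryCoord, faceCoord, Fin.cons_zero]
    linarith
  · simp [baryCoord, faceCoord]

lemma faceParam_faceCoord {n l : ℕ} {A : Finset (Fin n)} (hA : A.card = l + 1) {c : Fin n → ℝ}
    (hc : c ∈ closedFace A) : faceParam A hA (faceCoord A hA c) = c := by
  ext m
  by_cases hm : m ∈ A
  · obtain ⟨j, rfl⟩ := exists_emb hA hm
    rw [faceParam_emb, baryCoord_faceCoord hA hc, Real.sqrt_sq (hc.1 _)]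
  · rw [hc.2.1 m hm, faceParam, dif_neg hm]

lemma faceCoord_faceParam {n l : ℕ} {A : Finset (Fin n)} (hA : A.card = l + 1) {y : Fin l → ℝ}
    (hy : ∀ j, 0 ≤ y j) : faceCoord A hA (faceParam A hA y) = y := by
  ext j
  rw [faceCoord, faceParam_emb]
  simp [baryCoord, Real.sq_sqrt (hy j)]

lemma faceParam_mem_closedFace {n l : ℕ} {A : Finset (Fin n)} (hA : A.card = l + 1)
    {y : Fin l → ℝ} (hy : (∀ j, 0 ≤ y j) ∧ ∑ j, y j ≤ 1) : faceParam A hA y ∈ closedFace A := by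
  have hb : ∀ j, 0 ≤ baryCoord y j := fun j => by
    refine Fin.cases ?_ (fun i => ?_) j
    · simp only [baryCoord, Fin.cons_zero]
      linarith [hy.2]
    · simpa [baryCoord] using hy.1 i
  refine ⟨fun i => ?_, fun i hi => by rw [faceParam, dif_neg hi], ?_⟩
  · rw [faceParam]
    split_ifs
    · positivity
    · exact le_rfl
  · rw [sum_eq_sum_emb hA (f := fun i => faceParam A hA y i ^ 2)
      (fun i hi => by simp [faceParam, hi])]
    simp only [faceParam_emb, Real.sq_sqrt (hb _), sum_baryCoord]

lemma faceParam_mem_openFace {n l : ℕ} {A : Finset (Fin n)} (hA : A.card = l + 1)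
    {y : Fin l → ℝ} (hy : (∀ j, 0 < y j) ∧ ∑ j, y j < 1) : faceParam A hA y ∈ openFace A := by
  have hc := faceParam_mem_closedFace hA ⟨fun j => (hy.1 j).le, hy.2.le⟩
  refine ⟨fun i hi => ?_, hc.2⟩
  obtain ⟨j, rfl⟩ := exists_emb hA hi
  rw [faceParam_emb, Real.sqrt_pos]
  refine Fin.cases ?_ (fun i => ?_) j
  · simp only [baryCoord, Fin.cons_zero]
    linarith [hy.2]
  · simpa [baryCoord] using hy.1 i

lemma faceCoord_mem {n l : ℕ} {A : Finset (Fin n)} (hA : A.card = l + 1) {c : Fin n → ℝ}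
    (hc : c ∈ closedFace A) : (∀ j, 0 ≤ faceCoord A hA c j) ∧ ∑ j, faceCoord A hA c j ≤ 1 := by
  refine ⟨fun j => sq_nonneg _, ?_⟩
  have := baryCoord_faceCoord hA hc 0
  simp only [baryCoord, Fin.cons_zero] at this
  linarith [sq_nonneg (c (A.orderEmbOfFin hA 0))]

lemma faceCoord_mem_open {n l : ℕ} {A : Finset (Fin n)} (hA : A.card = l + 1) {c : Fin n → ℝ}
    (hc : c ∈ openFace A) : (∀ j, 0 < faceCoord A hA c j) ∧ ∑ j, faceCoord A hA c j < 1 := by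
  refine ⟨fun j => pow_pos (hc.1 _ (A.orderEmbOfFin_mem hA _)) 2, ?_⟩
  have := baryCoord_faceCoord hA (openFace_subset_closedFace subset_rfl hc) 0
  simp only [baryCoord, Fin.cons_zero] at this
  linarith [pow_pos (hc.1 _ (A.orderEmbOfFin_mem hA 0)) 2]

/-- The characteristic map of a face, defined on the cube. -/
lemma exists_characteristicMap {n l : ℕ} (A : Finset (Fin n)) (hA : A.card = l + 1) :
    ∃ Φ : PartialEquiv (Fin l → ℝ) (Fin n → ℝ), Φ.source = ball 0 1 ∧
      ContinuousOn Φ (closedBall 0 1) ∧ ContinuousOn Φ.symm Φ.target ∧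
      Φ '' ball 0 1 = openFace A ∧ Φ '' closedBall 0 1 = closedFace A ∧
      InjOn Φ (closedBall 0 1) := by
  obtain ⟨h, h1, h2⟩ := exists_homeomorph_simplex l
  have hball : ∀ z ∈ ball (0 : Fin l → ℝ) 1,
      (∀ j, 0 < h.symm z j) ∧ ∑ j, h.symm z j < 1 := fun z hz => by
    rw [← h1] at hz
    obtain ⟨y, hy, rfl⟩ := hz
    simpa using hy
  have hcball : ∀ z ∈ closedBall (0 : Fin l → ℝ) 1,
      (∀ j, 0 ≤ h.symm z j) ∧ ∑ j, h.symm z j ≤ 1 := fun z hz => by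
    rw [← h2] at hz
    obtain ⟨y, hy, rfl⟩ := hz
    simpa using hy
  let Φ : PartialEquiv (Fin l → ℝ) (Fin n → ℝ) :=
    { toFun := fun z => faceParam A hA (h.symm z)
      invFun := fun c => h (faceCoord A hA c)
      source := ball 0 1
      target := openFace A
      map_source' := fun z hz => faceParam_mem_openFace hA (hball z hz)
      map_target' := fun c hc => by
        rw [← h1]
        exact mem_image_of_mem _ (faceCoord_mem_open hA hc)
      left_inv' := fun z hz => by
        rw [faceCoord_faceParam hA fun j => ((hball z hz).1 j).le, h.apply_symm_apply]
      right_inv' := fun c hc => by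
        rw [h.symm_apply_apply,
          faceParam_faceCoord hA (openFace_subset_closedFace subset_rfl hc)] }
  refine ⟨Φ, rfl, ((continuous_faceParam A hA).comp h.symm.continuous).continuousOn, ?_,
    Φ.image_source_eq_target, ?_, ?_⟩
  · refine (h.continuous.comp ?_).continuousOn
    unfold faceCoord
    fun_prop
  · refine Subset.antisymm ?_ fun c hc => ?_
    · rintro _ ⟨z, hz, rfl⟩
      exact faceParam_mem_closedFace hA (hcball z hz)
    · refine ⟨h (faceCoord A hA c), ?_, ?_⟩
      · rw [← h2]
        exact mem_image_of_mem _ (faceCoord_mem hA hc)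
      · change faceParam A hA (h.symm (h _)) = c
        rw [h.symm_apply_apply, faceParam_faceCoord hA hc]
  · intro z hz z' hz' he
    have := congrArg (faceCoord A hA) (show faceParam A hA (h.symm z) = faceParam A hA (h.symm z')
      from he)
    rw [faceCoord_faceParam hA (hcball z hz).1, faceCoord_faceParam hA (hcball z' hz').1] at this
    exact h.symm.injective this

/-! ### The CW complex of faces -/

/-- The characteristic map of the face `A`. -/
def charMap {n l : ℕ} (A : Finset (Fin n)) (hA : A.card = l + 1) :
    PartialEquiv (Fin l → ℝ) (Fin n → ℝ) := (exists_characteristicMap A hA).choose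

lemma charMap_spec {n l : ℕ} (A : Finset (Fin n)) (hA : A.card = l + 1) :
    (charMap A hA).source = ball 0 1 ∧
      ContinuousOn (charMap A hA) (closedBall 0 1) ∧
      ContinuousOn (charMap A hA).symm (charMap A hA).target ∧
      charMap A hA '' ball 0 1 = openFace A ∧ charMap A hA '' closedBall 0 1 = closedFace A ∧
      InjOn (charMap A hA) (closedBall 0 1) := (exists_characteristicMap A hA).choose_spec

/-- A boundary point of the cube is mapped to a proper face. -/
lemma charMap_sphere {n l : ℕ} {A : Finset (Fin n)} (hA : A.card = l + 1) {z : Fin l → ℝ}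
    (hz : z ∈ sphere (0 : Fin l → ℝ) 1) :
    charMap A hA z ∈ closedFace A ∧ supp (charMap A hA z) ⊂ A := by
  obtain ⟨-, -, -, h1, h2, h3⟩ := charMap_spec A hA
  have hzc := sphere_subset_closedBall hz
  have hc : charMap A hA z ∈ closedFace A := h2 ▸ mem_image_of_mem _ hzc
  refine ⟨hc, (supp_subset hc).ssubset_of_ne fun h => ?_⟩
  have ho : charMap A hA z ∈ openFace A := mem_openFace_iff.2 ⟨hc, h⟩
  rw [← h1] at ho
  obtain ⟨z', hz', he⟩ := ho
  have := h3 (ball_subset_closedBall hz') hzc he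
  rw [this, mem_ball] at hz'
  exact hz'.ne hz

/-- The cell structure of a closed face: the cells are the nonempty sets of labels, and the
dimension of a cell is the number of its labels minus one. -/
@[reducible]
def faceComplex {n : ℕ} (S : Finset (Fin n)) (C : Set (Fin n → ℝ)) (hC : C = closedFace S) :
    Topology.CWComplex C :=
  Topology.CWComplex.mkFinite C (fun l => {A : Finset (Fin n) // A ⊆ S ∧ A.card = l + 1})
    (fun _ A => charMap A.1 A.2.2)
    (by
      filter_upwards [eventually_ge_atTop n] with l hl
      refine ⟨fun A => ?_⟩
      have := Finset.card_le_univ A.1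
      rw [A.2.2, Fintype.card_fin] at this
      omega)
    (fun _ => inferInstance)
    (fun _ A => (charMap_spec A.1 A.2.2).1)
    (fun _ A => (charMap_spec A.1 A.2.2).2.1)
    (fun _ A => (charMap_spec A.1 A.2.2).2.2.1)
    (by
      rintro ⟨l, A, hAS, hA⟩ - ⟨l', B, hBS, hB⟩ - hne
      simp only [Function.onFun, (charMap_spec A hA).2.2.2.1, (charMap_spec B hB).2.2.2.1]
      refine Set.disjoint_left.2 fun c hcA hcB => hne ?_
      have : A = B := (supp_eq_of_mem_openFace hcA).symm.trans (supp_eq_of_mem_openFace hcB)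
      subst this
      have : l = l' := by omega
      subst this
      rfl)
    (by
      rintro l ⟨A, hAS, hA⟩ z hz
      obtain ⟨hc, hlt⟩ := charMap_sphere hA hz
      have hpos := (supp_nonempty hc).card_pos
      have hcard := Finset.card_lt_card hlt
      have hB : (supp (charMap A hA z)).card = ((supp (charMap A hA z)).card - 1) + 1 := by omega
      simp only [mem_iUnion]
      refine ⟨(supp (charMap A hA z)).card - 1, by omega, ⟨_, hlt.subset.trans hAS, hB⟩, ?_⟩
      rw [(charMap_spec _ hB).2.2.2.2.1]
      exact openFace_subset_closedFace subset_rfl (mem_openFace_supp hc))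
    (by
      subst hC
      refine Subset.antisymm (iUnion_subset fun l => iUnion_subset fun A => ?_) fun c hc => ?_
      · rw [(charMap_spec _ A.2.2).2.2.2.2.1]
        exact closedFace_mono A.2.1
      · have hpos := (supp_nonempty hc).card_pos
        have hB : (supp c).card = ((supp c).card - 1) + 1 := by omega
        simp only [mem_iUnion]
        refine ⟨(supp c).card - 1, ⟨_, supp_subset hc, hB⟩, ?_⟩
        rw [(charMap_spec _ hB).2.2.2.2.1]
        exact openFace_subset_closedFace subset_rfl (mem_openFace_supp hc))

/-- A labelling of the cells of a CW complex by the nonempty subsets of `S`, for which the cells are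
the faces of the positive spherical simplex. -/
structure FaceLabelling {n : ℕ} (S : Finset (Fin n)) (C : Set (Fin n → ℝ))
    [Topology.CWComplex C] where
  face : CWCells C → Finset (Fin n)
  face_subset : ∀ e, face e ⊆ S
  card_face : ∀ e, (face e).card = e.1 + 1
  face_injective : Function.Injective face
  exists_cell : ∀ B ⊆ S, B.Nonempty → ∃ e, face e = B
  openCell_eq : ∀ e, cwOpen e = openFace (face e)
  closedCell_eq : ∀ e : CWCells C,
    Topology.CWComplex.closedCell (C := C) e.1 e.2 = closedFace (face e)
  injOn : ∀ e : CWCells C,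
    InjOn (Topology.CWComplex.map (C := C) e.1 e.2) (closedBall (0 : Fin e.1 → ℝ) 1)

/-- The labelling of the cells of `faceComplex`. -/
def faceLabelling {n : ℕ} (S : Finset (Fin n)) (C : Set (Fin n → ℝ)) (hC : C = closedFace S) :
    @FaceLabelling n S C (faceComplex S C hC) :=
  letI := faceComplex S C hC
  { face := fun e => e.2.1
    face_subset := fun e => e.2.2.1
    card_face := fun e => e.2.2.2
    face_injective := by
      rintro ⟨l, A, hAS, hA⟩ ⟨l', B, hBS, hB⟩ h
      obtain rfl : A = B := h
      obtain rfl : l = l' := by omega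
      rfl
    exists_cell := fun B hB hne =>
      ⟨⟨B.card - 1, B, hB, (Nat.sub_add_cancel hne.card_pos).symm⟩, rfl⟩
    openCell_eq := fun e => (charMap_spec _ e.2.2.2).2.2.2.1
    closedCell_eq := fun e => (charMap_spec _ e.2.2.2).2.2.2.2.1
    injOn := fun e => (charMap_spec _ e.2.2.2).2.2.2.2.2 }

namespace FaceLabelling

variable {n : ℕ} {S : Finset (Fin n)} {C : Set (Fin n → ℝ)} [Topology.CWComplex C]


lemma face_nonempty (F : FaceLabelling S C) (e : CWCells C) : (F.face e).Nonempty := by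
  rw [← Finset.card_pos, F.card_face]
  omega

lemma isFace_iff (F : FaceLabelling S C) {e' e : CWCells C} : IsFace e' e ↔ F.face e' ⊆ F.face e := by
  rw [IsFace, F.openCell_eq, F.closedCell_eq, openFace_subset_closedFace_iff (F.face_nonempty e')]

lemma map_mem (F : FaceLabelling S C) {e : CWCells C} {z : Fin e.1 → ℝ}
    (hz : z ∈ closedBall (0 : Fin e.1 → ℝ) 1) :
    Topology.CWComplex.map (C := C) e.1 e.2 z ∈ closedFace (F.face e) := by
  rw [← F.closedCell_eq]
  exact mem_image_of_mem _ hz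

lemma map_mem_openFace (F : FaceLabelling S C) {e : CWCells C} {z : Fin e.1 → ℝ}
    (hz : z ∈ ball (0 : Fin e.1 → ℝ) 1) :
    Topology.CWComplex.map (C := C) e.1 e.2 z ∈ openFace (F.face e) := by
  rw [← F.openCell_eq]
  exact mem_image_of_mem _ hz

lemma supp_map_ssubset (F : FaceLabelling S C) {e : CWCells C} {z : Fin e.1 → ℝ}
    (hz : z ∈ sphere (0 : Fin e.1 → ℝ) 1) :
    supp (Topology.CWComplex.map (C := C) e.1 e.2 z) ⊂ F.face e := by
  have hzc := sphere_subset_closedBall hz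
  refine (supp_subset (F.map_mem hzc)).ssubset_of_ne fun h => ?_
  have ho := mem_openFace_iff.2 ⟨F.map_mem hzc, h⟩
  rw [← F.openCell_eq] at ho
  obtain ⟨z', hz', he⟩ := ho
  have := F.injOn e (ball_subset_closedBall hz') hzc he
  rw [this, mem_ball] at hz'
  exact hz'.ne hz

lemma finite_cells (F : FaceLabelling S C) : Finite (CWCells C) := Finite.of_injective F.face F.face_injective

/-- The open `l`-cells are the sets `𝕊^{l,γ}_{>0}`. -/
lemma range_openCell (F : FaceLabelling S C) {k : ℕ} (hkn : k ≤ n)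
    {σ : Equiv.Perm (Fin n)} (hS : S = initialValues k σ)
    (l : ℕ) :
    Set.range (fun e : Topology.CWComplex.cell C l =>
        Topology.CWComplex.openCell (C := C) l e) =
      {A | ∃ γ ∈ subShuffles n k σ (l + 1), A = spherePos n (l + 1) γ} := by
  ext A
  constructor
  · rintro ⟨e, rfl⟩
    obtain ⟨γ, hγ, hγe⟩ := exists_subShuffle hkn (F.card_face ⟨l, e⟩)
      ((F.face_subset ⟨l, e⟩).trans hS.subset)
    exact ⟨γ, hγ, by rw [spherePos_eq, hγe]; exact F.openCell_eq ⟨l, e⟩⟩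
  · rintro ⟨γ, hγ, rfl⟩
    have hcard := card_initialValues (hγ.2.1.trans hkn) γ
    obtain ⟨⟨d, e⟩, he⟩ := F.exists_cell (initialValues (l + 1) γ)
      ((initialValues_subset hγ).trans hS.superset) (by rw [← Finset.card_pos]; omega)
    have hd := F.card_face ⟨d, e⟩
    rw [he, hcard] at hd
    obtain rfl : l = d := by simpa using hd
    exact ⟨e, by rw [spherePos_eq, ← he]; exact F.openCell_eq ⟨l, e⟩⟩

end FaceLabelling

/-! ### Polar coordinates on the invariant ellipsoid -/

/-- The linear subspace of the states whose planes outside `S` vanish. -/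
def coordPlane {n : ℕ} (S : Finset (Fin n)) : Set (State n) :=
  {p | ∀ i ∉ S, p.1 i = 0 ∧ p.2 i = 0}

/-- The ellipsoid `ν + ∑ a_j ρ_j² = 0` in the subspace with labels `S`. -/
def toralSet {n : ℕ} (a : Fin n → ℝ) (ν : ℝ) (S : Finset (Fin n)) : Set (State n) :=
  {p | p ∈ coordPlane S ∧ ν + quad a p = 0}

lemma radius_nonneg {n : ℕ} (p : State n) (i : Fin n) : 0 ≤ radius p i := Real.sqrt_nonneg _

lemma radius_sq {n : ℕ} (p : State n) (i : Fin n) :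
    radius p i ^ 2 = p.1 i ^ 2 + p.2 i ^ 2 := Real.sq_sqrt (by positivity)

lemma radius_eq_zero {n : ℕ} {p : State n} {i : Fin n} :
    radius p i = 0 ↔ p.1 i = 0 ∧ p.2 i = 0 := by
  rw [← sq_eq_zero_iff, radius_sq]
  constructor
  · intro h
    constructor <;> nlinarith [sq_nonneg (p.1 i), sq_nonneg (p.2 i)]
  · rintro ⟨h1, h2⟩
    simp [h1, h2]

lemma quad_eq_sum_radius {n : ℕ} (b : Fin n → ℝ) (p : State n) :
    quad b p = ∑ j, b j * radius p j ^ 2 := by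
  simp only [quad, radius_sq]

lemma sum_radius_sq {n : ℕ} (p : State n) : ∑ j, radius p j ^ 2 = quad 1 p := by
  simp [quad_eq_sum_radius]

lemma mem_coordPlane {n : ℕ} {S : Finset (Fin n)} {p : State n} :
    p ∈ coordPlane S ↔ supp (radius p) ⊆ S := by
  refine ⟨fun h i hi => by_contra fun hS => mem_supp.1 hi (radius_eq_zero.2 (h i hS)),
    fun h i hi => radius_eq_zero.1 (by_contra fun h0 => hi (h (mem_supp.2 h0)))⟩

lemma mem_stateCell {n l : ℕ} {γ : Equiv.Perm (Fin n)} {p : State n} :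
    p ∈ stateCell n l γ ↔ supp (radius p) = initialValues l γ := by
  have h0 : ∀ i, (p.1 i, p.2 i) = (0, 0) ↔ radius p i = 0 := fun i => by
    rw [radius_eq_zero, Prod.mk.injEq]
  simp only [stateCell, mem_ofPred_eq, ne_eq, h0]
  constructor
  · rintro ⟨h1, h2⟩
    ext m
    obtain ⟨i, rfl⟩ := γ.surjective m
    rw [mem_supp, apply_mem_initialValues]
    exact ⟨fun h => not_le.1 fun hi => h (h2 i hi), h1 i⟩
  · intro h
    refine ⟨fun i hi => ?_, fun i hi => ?_⟩
    · rw [← ne_eq, ← mem_supp, h, apply_mem_initialValues]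
      exact hi
    · by_contra h0
      rw [← ne_eq, ← mem_supp, h, apply_mem_initialValues] at h0
      omega

lemma continuous_radius {n : ℕ} (i : Fin n) : Continuous fun p : State n => radius p i := by
  unfold radius
  fun_prop

/-- The Euclidean norm of a state. -/
def stateNorm {n : ℕ} (p : State n) : ℝ := √(∑ j, radius p j ^ 2)

lemma stateNorm_pos {n : ℕ} {p : State n} (hp : p ≠ 0) : 0 < stateNorm p := by
  rw [stateNorm, sum_radius_sq]
  exact Real.sqrt_pos.2 (quad_one_pos hp)

lemma stateNorm_mul_direction {n : ℕ} {p : State n} (hp : p ≠ 0) (i : Fin n) :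
    stateNorm p * direction p i = radius p i :=
  mul_div_cancel₀ _ (stateNorm_pos hp).ne'

lemma supp_direction {n : ℕ} {p : State n} (hp : p ≠ 0) : supp (direction p) = supp (radius p) := by
  ext i
  rw [mem_supp, mem_supp, ← stateNorm_mul_direction hp, mul_ne_zero_iff,
    and_iff_right (stateNorm_pos hp).ne']

lemma direction_mem_closedFace {n : ℕ} {S : Finset (Fin n)} {p : State n} (hp : p ≠ 0)
    (hS : p ∈ coordPlane S) : direction p ∈ closedFace S := by
  refine ⟨fun i => div_nonneg (radius_nonneg p i) (Real.sqrt_nonneg _), fun i hi => ?_, ?_⟩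
  · rw [direction, radius_eq_zero.2 (hS i hi), zero_div]
  · have h := stateNorm_pos hp
    have h2 : stateNorm p ^ 2 = ∑ j, radius p j ^ 2 :=
      Real.sq_sqrt (Finset.sum_nonneg fun i _ => sq_nonneg _)
    have : ∀ i, direction p i ^ 2 = radius p i ^ 2 / stateNorm p ^ 2 := fun i => div_pow _ _ _
    simp only [this, ← Finset.sum_div]
    rw [← h2, div_self (by positivity)]

/-- A state whose radii are proportional to the unit vector `c` has direction `c`. -/
lemma direction_eq {n : ℕ} {c : Fin n → ℝ} (hc : ∑ i, c i ^ 2 = 1) {r : ℝ} (hr : 0 < r)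
    {p : State n} (h : ∀ i, radius p i = r * c i) : direction p = c := by
  have : √(∑ j, radius p j ^ 2) = r := by
    simp only [h, mul_pow, ← Finset.mul_sum, hc, mul_one, Real.sqrt_sq hr.le]
  ext i
  rw [direction, this, h, mul_div_cancel_left₀ _ hr.ne']

lemma quad_eq_of_radius {n : ℕ} (b : Fin n → ℝ) {c : Fin n → ℝ} {r : ℝ}
    {p : State n} (h : ∀ i, radius p i = r * c i) : quad b p = r ^ 2 * ∑ j, b j * c j ^ 2 := by
  rw [quad_eq_sum_radius, Finset.mul_sum]
  exact Finset.sum_congr rfl fun j _ => by rw [h]; ring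

lemma continuousAt_direction {n : ℕ} {p : State n} (hp : p ≠ 0) :
    ContinuousAt (direction (n := n)) p := by
  refine continuousAt_pi.2 fun i => ?_
  have hr : ∀ j, Continuous fun q : State n => radius q j := continuous_radius
  refine ContinuousAt.div (hr i).continuousAt ?_ (stateNorm_pos hp).ne'
  exact (continuous_finsetSum _ fun j _ => (hr j).pow 2).sqrt.continuousAt

/-- The angular coordinate of the `i`-th plane (equal to `1` where the plane vanishes). -/
def phase {n : ℕ} (p : State n) (i : Fin n) : Circle := Circle.exp (Complex.arg ⟨p.1 i, p.2 i⟩)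

lemma radius_eq_norm {n : ℕ} (p : State n) (i : Fin n) :
    radius p i = ‖(⟨p.1 i, p.2 i⟩ : ℂ)‖ := by
  rw [radius, Complex.norm_def, Complex.normSq_mk, sq, sq]

lemma radius_mul_phase {n : ℕ} (p : State n) (i : Fin n) :
    (radius p i : ℂ) * (phase p i : ℂ) = ⟨p.1 i, p.2 i⟩ := by
  rw [radius_eq_norm, phase, Circle.coe_exp, Complex.norm_mul_exp_arg_mul_I]

lemma radius_mul_phase_re {n : ℕ} (p : State n) (i : Fin n) :
    radius p i * (phase p i : ℂ).re = p.1 i := by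
  rw [← Complex.re_ofReal_mul, radius_mul_phase]

lemma radius_mul_phase_im {n : ℕ} (p : State n) (i : Fin n) :
    radius p i * (phase p i : ℂ).im = p.2 i := by
  rw [← Complex.im_ofReal_mul, radius_mul_phase]

lemma continuous_phase {n : ℕ} {Z : Type*} [TopologicalSpace Z] {f : Z → State n}
    (hf : Continuous f) {i : Fin n} (h : ∀ z, radius (f z) i ≠ 0) :
    Continuous fun z => phase (f z) i := by
  refine continuous_induced_rng.2 ?_
  have hr := (continuous_radius i).comp hf
  have h1 : Continuous fun z => (f z).1 i / radius (f z) i :=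
    Continuous.div ((continuous_apply i).comp hf.fst) hr h
  have h2 : Continuous fun z => (f z).2 i / radius (f z) i :=
    Continuous.div ((continuous_apply i).comp hf.snd) hr h
  have h3 : Continuous fun z => (((f z).1 i / radius (f z) i : ℝ) : ℂ) +
      (((f z).2 i / radius (f z) i : ℝ) : ℂ) * Complex.I := by fun_prop
  refine h3.congr fun z => ?_
  have hz : (radius (f z) i : ℂ) ≠ 0 := Complex.ofReal_ne_zero.2 (h z)
  refine mul_left_cancel₀ hz (Eq.trans ?_ (radius_mul_phase (f z) i).symm)
  rw [Complex.mk_eq_add_mul_I]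
  push_cast
  field_simp

lemma circle_re_sq_add_im_sq (z : Circle) : (z : ℂ).re ^ 2 + (z : ℂ).im ^ 2 = 1 := by
  have := Circle.normSq_coe z
  rw [Complex.normSq_apply] at this
  linarith

/-- The point with angular coordinates `s` and radii `r * c`, the planes without label being `0`. -/
def polarPoint {n : ℕ} {Q : Fin n → Prop} (s : {m // Q m} → Circle) (r : ℝ) (c : Fin n → ℝ) :
    State n :=
  open Classical in
  (fun i => if h : Q i then r * c i * (s ⟨i, h⟩ : ℂ).re else 0,
   fun i => if h : Q i then r * c i * (s ⟨i, h⟩ : ℂ).im else 0)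

lemma radius_polarPoint {n : ℕ} {Q : Fin n → Prop} (s : {m // Q m} → Circle) {r : ℝ}
    (hr : 0 ≤ r) {c : Fin n → ℝ} (hc : ∀ i, 0 ≤ c i) (hQ : ∀ i, ¬ Q i → c i = 0) (i : Fin n) :
    radius (polarPoint s r c) i = r * c i := by
  by_cases h : Q i
  · simp only [radius, polarPoint, h, dite_true]
    rw [show (r * c i * (s ⟨i, h⟩ : ℂ).re) ^ 2 + (r * c i * (s ⟨i, h⟩ : ℂ).im) ^ 2 =
      (r * c i) ^ 2 by linear_combination (r * c i) ^ 2 * circle_re_sq_add_im_sq (s ⟨i, h⟩),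
      Real.sqrt_sq (mul_nonneg hr (hc i))]
  · simp [radius, polarPoint, h, hQ i h]

lemma polarPoint_phase {n : ℕ} {Q : Fin n → Prop} {p : State n} (hp : p ≠ 0)
    (hQ : ∀ i, ¬ Q i → radius p i = 0) :
    polarPoint (fun m : {m // Q m} => phase p m) (stateNorm p) (direction p) = p := by
  refine Prod.ext (funext fun i => ?_) (funext fun i => ?_)
  · by_cases h : Q i
    · simp only [polarPoint, h, dite_true, stateNorm_mul_direction hp, radius_mul_phase_re]
    · simp [polarPoint, h, (radius_eq_zero.1 (hQ i h)).1]
  · by_cases h : Q i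
    · simp only [polarPoint, h, dite_true, stateNorm_mul_direction hp, radius_mul_phase_im]
    · simp [polarPoint, h, (radius_eq_zero.1 (hQ i h)).2]

/-- Two polar points with the same radii agree exactly if their angles agree wherever the radius does
not vanish. -/
lemma polarPoint_eq_iff {n : ℕ} {Q : Fin n → Prop} {s s' : {m // Q m} → Circle} {r : ℝ}
    (hr : 0 < r) {c : Fin n → ℝ} :
    polarPoint s r c = polarPoint s' r c ↔ ∀ m : {m // Q m}, c m ≠ 0 → s m = s' m := by
  constructor
  · intro h m hm
    have h1 := congrFun (congrArg Prod.fst h) m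
    have h2 := congrFun (congrArg Prod.snd h) m
    have hrc : r * c m ≠ 0 := mul_ne_zero hr.ne' hm
    simp only [polarPoint, m.2, dite_true, mul_right_inj' hrc] at h1 h2
    exact Circle.ext (Complex.ext h1 h2)
  · intro h
    refine Prod.ext (funext fun i => ?_) (funext fun i => ?_) <;>
    · by_cases hQ : Q i
      · by_cases hi : c i = 0
        · simp [polarPoint, hi]
        · simp [polarPoint, hQ, h ⟨i, hQ⟩ hi]
      · simp [polarPoint, hQ]

lemma continuous_polarPoint {n : ℕ} {Q : Fin n → Prop} {Z : Type*} [TopologicalSpace Z]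
    {s : Z → {m // Q m} → Circle} {r : Z → ℝ} {c : Z → Fin n → ℝ} (hs : Continuous s)
    (hr : Continuous r) (hc : Continuous c) :
    Continuous fun z => polarPoint (s z) (r z) (c z) := by
  refine Continuous.prodMk (continuous_pi fun i => ?_) (continuous_pi fun i => ?_) <;>
  · by_cases h : Q i
    · have h1 : Continuous fun z => (s z ⟨i, h⟩ : ℂ) :=
        continuous_induced_dom.comp ((continuous_apply _).comp hs)
      have h2 := Complex.continuous_re.comp h1
      have h3 := Complex.continuous_im.comp h1
      have h4 := hr.mul ((continuous_apply i).comp hc)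
      simp only [h, dite_true]
      first | exact h4.mul h2 | exact h4.mul h3
    · simp only [h, dite_false]
      exact continuous_const

/-- The norm of the points of the ellipsoid with direction `c`. -/
def ellRadius {n : ℕ} (a : Fin n → ℝ) (ν : ℝ) (c : Fin n → ℝ) : ℝ :=
  √(-ν / ∑ j, a j * c j ^ 2)

section Ellipsoid

/-! On the labels `S` all `a_j` have the sign of the number `α`. -/

variable {n : ℕ} {S : Finset (Fin n)} {a : Fin n → ℝ} {α ν : ℝ}

lemma mul_weightedSum_pos (hα : ∀ j ∈ S, 0 < α * a j) {c : Fin n → ℝ} (hc : c ∈ closedFace S) :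
    0 < α * ∑ j, a j * c j ^ 2 := by
  obtain ⟨i, hi⟩ := supp_nonempty hc
  rw [Finset.mul_sum]
  refine Finset.sum_pos' (fun j _ => ?_) ⟨i, Finset.mem_univ i, ?_⟩
  · by_cases hj : j ∈ S
    · rw [← mul_assoc]
      exact mul_nonneg (hα j hj).le (sq_nonneg _)
    · simp [hc.2.1 j hj]
  · rw [← mul_assoc]
    exact mul_pos (hα i (supp_subset hc hi)) (pow_pos (lt_of_le_of_ne (hc.1 i)
      (mem_supp.1 hi).symm) 2)

lemma ell_pos (hα : ∀ j ∈ S, 0 < α * a j) (hν : α * ν < 0) {c : Fin n → ℝ}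
    (hc : c ∈ closedFace S) : 0 < -ν / ∑ j, a j * c j ^ 2 := by
  have h1 := mul_weightedSum_pos hα hc
  have hα0 : α ≠ 0 := by rintro rfl; simp at h1
  rw [← mul_div_mul_left _ _ hα0]
  exact div_pos (by linarith) h1

lemma ellRadius_pos (hα : ∀ j ∈ S, 0 < α * a j) (hν : α * ν < 0) {c : Fin n → ℝ}
    (hc : c ∈ closedFace S) : 0 < ellRadius a ν c := Real.sqrt_pos.2 (ell_pos hα hν hc)

lemma ellRadius_sq (hα : ∀ j ∈ S, 0 < α * a j) (hν : α * ν < 0) {c : Fin n → ℝ}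
    (hc : c ∈ closedFace S) : ellRadius a ν c ^ 2 * ∑ j, a j * c j ^ 2 = -ν := by
  have h1 := mul_weightedSum_pos hα hc
  rw [ellRadius, Real.sq_sqrt (ell_pos hα hν hc).le, div_mul_cancel₀]
  rintro h
  simp [h] at h1

lemma continuous_ellRadius (hα : ∀ j ∈ S, 0 < α * a j) {Z : Type*} [TopologicalSpace Z]
    {c : Z → Fin n → ℝ} (hc : Continuous c) (hcS : ∀ z, c z ∈ closedFace S) :
    Continuous fun z => ellRadius a ν (c z) := by
  refine (Continuous.div continuous_const ?_ fun z h => ?_).sqrt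
  · fun_prop
  · have h1 := mul_weightedSum_pos hα (hcS z)
    simp [h] at h1

/-- On the subspace with labels `S` the form `∑ a_j ρ_j²` is definite, with the sign of `α`. -/
lemma mul_quad_pos (hα : ∀ j ∈ S, 0 < α * a j) {p : State n} (hp : p ∈ coordPlane S)
    (h0 : p ≠ 0) : 0 < α * quad a p := by
  rw [quad_eq_of_radius a fun i => (stateNorm_mul_direction h0 i).symm, mul_left_comm]
  exact mul_pos (pow_pos (stateNorm_pos h0) 2)
    (mul_weightedSum_pos hα (direction_mem_closedFace h0 hp))

lemma quad_zero (b : Fin n → ℝ) : quad b (0 : State n) = 0 := by simp [quad]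

lemma mul_quad_nonneg (hα : ∀ j ∈ S, 0 < α * a j) {p : State n} (hp : p ∈ coordPlane S) :
    0 ≤ α * quad a p := by
  by_cases h0 : p = 0
  · simp [h0, quad_zero]
  · exact (mul_quad_pos hα hp h0).le

lemma ne_zero_of_mem_toralSet (hν : α * ν < 0) {p : State n} (hp : p ∈ toralSet a ν S) :
    p ≠ 0 := by
  rintro rfl
  have := hp.2
  rw [quad_zero, add_zero] at this
  simp [this] at hν

lemma polarPoint_mem_toralSet (hα : ∀ j ∈ S, 0 < α * a j) (hν : α * ν < 0) {Q : Fin n → Prop}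
    (s : {m // Q m} → Circle) {c : Fin n → ℝ} (hc : c ∈ closedFace S)
    (hcQ : ∀ i, ¬ Q i → c i = 0) : polarPoint s (ellRadius a ν c) c ∈ toralSet a ν S := by
  have h := radius_polarPoint s (ellRadius_pos hα hν hc).le hc.1 hcQ
  refine ⟨fun i hi => radius_eq_zero.1 (by rw [h, hc.2.1 i hi, mul_zero]), ?_⟩
  rw [quad_eq_of_radius a h, ellRadius_sq hα hν hc]
  ring

lemma supp_polarPoint (hα : ∀ j ∈ S, 0 < α * a j) (hν : α * ν < 0) {Q : Fin n → Prop}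
    (s : {m // Q m} → Circle) {c : Fin n → ℝ} (hc : c ∈ closedFace S)
    (hcQ : ∀ i, ¬ Q i → c i = 0) :
    supp (radius (polarPoint s (ellRadius a ν c) c)) = supp c := by
  have h := ellRadius_pos hα hν hc
  ext i
  rw [mem_supp, mem_supp, radius_polarPoint s h.le hc.1 hcQ, mul_ne_zero_iff,
    and_iff_right h.ne']

lemma direction_polarPoint (hα : ∀ j ∈ S, 0 < α * a j) (hν : α * ν < 0) {Q : Fin n → Prop}
    (s : {m // Q m} → Circle) {c : Fin n → ℝ} (hc : c ∈ closedFace S)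
    (hcQ : ∀ i, ¬ Q i → c i = 0) :
    direction (polarPoint s (ellRadius a ν c) c) = c :=
  direction_eq hc.2.2 (ellRadius_pos hα hν hc)
    (radius_polarPoint s (ellRadius_pos hα hν hc).le hc.1 hcQ)

lemma polarPoint_ell_eq_iff (hα : ∀ j ∈ S, 0 < α * a j) (hν : α * ν < 0) {Q : Fin n → Prop}
    {s s' : {m // Q m} → Circle} {c c' : Fin n → ℝ} (hc : c ∈ closedFace S)
    (hc' : c' ∈ closedFace S) (hcQ : ∀ i, ¬ Q i → c i = 0) (hcQ' : ∀ i, ¬ Q i → c' i = 0) :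
    polarPoint s (ellRadius a ν c) c = polarPoint s' (ellRadius a ν c') c' ↔
      c = c' ∧ ∀ m : {m // Q m}, c m ≠ 0 → s m = s' m := by
  constructor
  · intro h
    obtain rfl : c = c' := by
      rw [← direction_polarPoint hα hν s hc hcQ, h, direction_polarPoint hα hν s' hc' hcQ']
    exact ⟨rfl, (polarPoint_eq_iff (ellRadius_pos hα hν hc)).1 h⟩
  · rintro ⟨rfl, h⟩
    exact (polarPoint_eq_iff (ellRadius_pos hα hν hc)).2 h

lemma ellRadius_direction (hα : ∀ j ∈ S, 0 < α * a j) (hν : α * ν < 0) {p : State n}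
    (hp : p ∈ toralSet a ν S) : ellRadius a ν (direction p) = stateNorm p := by
  have h0 := ne_zero_of_mem_toralSet hν hp
  have hd := direction_mem_closedFace h0 hp.1
  have h1 := ellRadius_sq hα hν hd
  have h2 := hp.2
  rw [quad_eq_of_radius a fun i => (stateNorm_mul_direction h0 i).symm] at h2
  have h3 : ∑ j, a j * direction p j ^ 2 ≠ 0 := fun h => by
    have := mul_weightedSum_pos hα hd
    simp [h] at this
  have h4 : ellRadius a ν (direction p) ^ 2 = stateNorm p ^ 2 :=
    mul_right_cancel₀ h3 (by linarith)
  exact (sq_eq_sq₀ (Real.sqrt_nonneg _) (Real.sqrt_nonneg _)).1 h4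

lemma polarPoint_ell_phase (hα : ∀ j ∈ S, 0 < α * a j) (hν : α * ν < 0) {Q : Fin n → Prop}
    {p : State n} (hp : p ∈ toralSet a ν S) (hQ : ∀ i, ¬ Q i → radius p i = 0) :
    polarPoint (fun m : {m // Q m} => phase p m) (ellRadius a ν (direction p)) (direction p) =
      p := by
  rw [ellRadius_direction hα hν hp, polarPoint_phase (ne_zero_of_mem_toralSet hν hp) hQ]

lemma phase_polarPoint (hα : ∀ j ∈ S, 0 < α * a j) (hν : α * ν < 0) {Q : Fin n → Prop}
    (s : {m // Q m} → Circle) {c : Fin n → ℝ} (hc : c ∈ closedFace S)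
    (hcQ : ∀ i, ¬ Q i → c i = 0) (m : {m // Q m}) (hm : c m ≠ 0) :
    phase (polarPoint s (ellRadius a ν c) c) m = s m := by
  have hmem := polarPoint_mem_toralSet hα hν s hc hcQ
  have hr := ellRadius_pos hα hν hc
  have h := polarPoint_ell_phase hα hν (Q := Q) hmem fun i hi => by
    rw [radius_polarPoint s hr.le hc.1 hcQ, hcQ i hi, mul_zero]
  rw [direction_polarPoint hα hν s hc hcQ] at h
  exact (polarPoint_eq_iff hr).1 h m hm

end Ellipsoid

/-! ### The toral CW complex -/

section ToralComplex

variable {n : ℕ} {S : Finset (Fin n)} {a : Fin n → ℝ} {α ν : ℝ}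

/-- The points of the ellipsoid in which exactly the planes with labels in `A` do not vanish. -/
def openToralCell (a : Fin n → ℝ) (ν : ℝ) (S A : Finset (Fin n)) : Set (toralSet a ν S) :=
  {p | supp (radius p.1) = A}

lemma closedFace_zero {A : Finset (Fin n)} {c : Fin n → ℝ} (hc : c ∈ closedFace A) :
    ∀ i, ¬ (i ∈ A) → c i = 0 := hc.2.1

/-- The open toral cell is the product of a torus and the open face, by polar coordinates. -/
def toralTriv (hα : ∀ j ∈ S, 0 < α * a j) (hν : α * ν < 0) {A : Finset (Fin n)} (hA : A ⊆ S)
    {O : Set (Fin n → ℝ)} (hO : O = openFace A) :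
    openToralCell a ν S A ≃ₜ ({m // m ∈ A} → Circle) × O where
  toFun p := (fun m => phase p.1.1 m, ⟨direction p.1.1, by
    have h0 := ne_zero_of_mem_toralSet hν p.1.2
    rw [hO, mem_openFace_iff, supp_direction h0]
    refine ⟨direction_mem_closedFace h0 (mem_coordPlane.2 ?_), p.2⟩
    exact Eq.subset p.2⟩)
  invFun u :=
    have hu : u.2.1 ∈ openFace A := hO ▸ u.2.2
    have hc := openFace_subset_closedFace subset_rfl hu
    ⟨⟨polarPoint u.1 (ellRadius a ν u.2.1) u.2.1,
      polarPoint_mem_toralSet hα hν u.1 (closedFace_mono hA hc) (closedFace_zero hc)⟩, by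
        have := supp_polarPoint hα hν u.1 (closedFace_mono hA hc) (closedFace_zero hc)
        exact this.trans (supp_eq_of_mem_openFace hu)⟩
  left_inv p := by
    refine Subtype.ext (Subtype.ext (polarPoint_ell_phase hα hν p.1.2 fun i hi => ?_))
    by_contra h
    exact hi (p.2 ▸ mem_supp.2 h)
  right_inv u := by
    have hu : u.2.1 ∈ openFace A := hO ▸ u.2.2
    have hc := openFace_subset_closedFace subset_rfl hu
    refine Prod.ext (funext fun m => ?_) (Subtype.ext ?_)
    · exact phase_polarPoint hα hν u.1 (closedFace_mono hA hc) (closedFace_zero hc) m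
        (hu.1 m m.2).ne'
    · exact direction_polarPoint hα hν u.1 (closedFace_mono hA hc) (closedFace_zero hc)
  continuous_toFun := by
    have hval : Continuous fun p : openToralCell a ν S A => p.1.1 :=
      continuous_subtype_val.comp continuous_subtype_val
    refine Continuous.prodMk (continuous_pi fun m => continuous_phase hval fun p => ?_)
      (Continuous.subtype_mk ?_ _)
    · exact mem_supp.1 (Eq.superset p.2 m.2)
    · exact continuous_iff_continuousAt.2 fun p => ContinuousAt.comp
        (f := fun p : openToralCell a ν S A => p.1.1)
        (continuousAt_direction (ne_zero_of_mem_toralSet hν p.1.2)) hval.continuousAt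
  continuous_invFun := by
    refine Continuous.subtype_mk (Continuous.subtype_mk ?_ _) _
    have hc : Continuous fun u : ({m // m ∈ A} → Circle) × O => u.2.1 :=
      continuous_subtype_val.comp continuous_snd
    exact continuous_polarPoint continuous_fst (continuous_ellRadius hα hc fun u =>
      openFace_subset_closedFace hA (hO ▸ u.2.2)) hc

lemma isClosed_coordPlane (S : Finset (Fin n)) : IsClosed (coordPlane S) := by
  simp only [coordPlane, ofPred_forall]
  refine isClosed_iInter fun i => isClosed_iInter fun _ => IsClosed.and ?_ ?_
  · exact isClosed_eq (by fun_prop) continuous_const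
  · exact isClosed_eq (by fun_prop) continuous_const

section Attach

variable {C : Set (Fin n → ℝ)} [Topology.CWComplex C]

/-- The map (torus) × (closed ball) → ellipsoid that covers the characteristic map of a cell. -/
def attachFun (F : FaceLabelling S C) (hα : ∀ j ∈ S, 0 < α * a j) (hν : α * ν < 0)
    (e : CWCells C) (u : ({m // m ∈ F.face e} → Circle) × closedBall (0 : Fin e.1 → ℝ) 1) :
    toralSet a ν S :=
  ⟨polarPoint u.1 (ellRadius a ν (Topology.CWComplex.map (C := C) e.1 e.2 u.2))
    (Topology.CWComplex.map (C := C) e.1 e.2 u.2),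
    polarPoint_mem_toralSet hα hν u.1 (closedFace_mono (F.face_subset e) (F.map_mem u.2.2))
      (closedFace_zero (F.map_mem u.2.2))⟩

lemma continuous_attachFun (F : FaceLabelling S C) (hα : ∀ j ∈ S, 0 < α * a j) (hν : α * ν < 0)
    (e : CWCells C) : Continuous (attachFun F hα hν e) := by
  refine Continuous.subtype_mk ?_ _
  have hc : Continuous fun u : ({m // m ∈ F.face e} → Circle) × closedBall (0 : Fin e.1 → ℝ) 1 =>
      Topology.CWComplex.map (C := C) e.1 e.2 u.2 :=
    (continuousOn_iff_continuous_domRestrict.1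
      (Topology.CWComplex.continuousOn (C := C) e.1 e.2)).comp continuous_snd
  exact continuous_polarPoint continuous_fst (continuous_ellRadius hα hc fun u =>
    closedFace_mono (F.face_subset e) (F.map_mem u.2.2)) hc

lemma supp_attachFun (F : FaceLabelling S C) (hα : ∀ j ∈ S, 0 < α * a j) (hν : α * ν < 0)
    (e : CWCells C) (u : ({m // m ∈ F.face e} → Circle) × closedBall (0 : Fin e.1 → ℝ) 1) :
    supp (radius (attachFun F hα hν e u).1) =
      supp (Topology.CWComplex.map (C := C) e.1 e.2 u.2) :=
  supp_polarPoint hα hν u.1 (closedFace_mono (F.face_subset e) (F.map_mem u.2.2))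
    (closedFace_zero (F.map_mem u.2.2))

/-- The image of the attaching map consists of the points whose nonzero planes have labels in the
face. -/
lemma range_attachFun (F : FaceLabelling S C) (hα : ∀ j ∈ S, 0 < α * a j) (hν : α * ν < 0)
    (e : CWCells C) : range (attachFun F hα hν e) = {p | supp (radius p.1) ⊆ F.face e} := by
  ext p
  constructor
  · rintro ⟨u, rfl⟩
    rw [mem_ofPred_eq, supp_attachFun]
    exact supp_subset (F.map_mem u.2.2)
  · intro hp
    have h0 := ne_zero_of_mem_toralSet hν p.2
    have hd : direction p.1 ∈ closedFace (F.face e) :=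
      direction_mem_closedFace h0 (mem_coordPlane.2 hp)
    rw [← F.closedCell_eq] at hd
    obtain ⟨z, hz, he⟩ := hd
    replace he : Topology.CWComplex.map (C := C) e.1 e.2 z = direction p.1 := he
    refine ⟨(fun m => phase p.1 m, ⟨z, hz⟩), Subtype.ext ?_⟩
    simp only [attachFun, he]
    refine polarPoint_ell_phase hα hν p.2 fun i hi => ?_
    by_contra h
    exact hi (hp (mem_supp.2 h))

lemma closure_openToralCell (F : FaceLabelling S C) (hα : ∀ j ∈ S, 0 < α * a j) (hν : α * ν < 0)
    (e : CWCells C) :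
    closure (openToralCell a ν S (F.face e)) = {p | supp (radius p.1) ⊆ F.face e} := by
  refine Subset.antisymm (closure_minimal (fun p hp => hp.subset) ?_) ?_
  · simp only [← mem_coordPlane]
    exact (isClosed_coordPlane _).preimage continuous_subtype_val
  -- the open ball is dense in the closed ball, and its image is the open toral cell
  · rw [← range_attachFun F hα hν e, ← image_univ]
    have hdense : closure {u : ({m // m ∈ F.face e} → Circle) × closedBall (0 : Fin e.1 → ℝ) 1 |
        u.2.1 ∈ ball (0 : Fin e.1 → ℝ) 1} = univ := by
      rw [← dense_iff_closure_eq]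
      have h1 : Dense {z : closedBall (0 : Fin e.1 → ℝ) 1 | z.1 ∈ ball (0 : Fin e.1 → ℝ) 1} := by
        rw [Subtype.dense_iff]
        intro z hz
        have : (Subtype.val '' {z : closedBall (0 : Fin e.1 → ℝ) 1 |
            z.1 ∈ ball (0 : Fin e.1 → ℝ) 1}) = ball (0 : Fin e.1 → ℝ) 1 := by
          ext y
          exact ⟨by rintro ⟨w, hw, rfl⟩; exact hw,
            fun hy => ⟨⟨y, ball_subset_closedBall hy⟩, hy, rfl⟩⟩
        rw [this, closure_ball _ one_ne_zero]
        exact hz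
      exact h1.preimage isOpenMap_snd
    rw [← hdense]
    refine (image_closure_subset_closure_image (continuous_attachFun F hα hν e)).trans
      (closure_mono ?_)
    rintro _ ⟨u, hu, rfl⟩
    exact (supp_attachFun F hα hν e u).trans (supp_eq_of_mem_openFace (F.map_mem_openFace hu))

/-- Two points are attached at the same point exactly if they are identified by the collapse of the
circle factors. -/
lemma attachFun_eq_iff (F : FaceLabelling S C) (hα : ∀ j ∈ S, 0 < α * a j) (hν : α * ν < 0)
    (e : CWCells C) (u v : ({m // m ∈ F.face e} → Circle) × closedBall (0 : Fin e.1 → ℝ) 1) :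
    attachFun F hα hν e u = attachFun F hα hν e v ↔
      (collapse (fun e => {m // m ∈ F.face e})
        (fun _ _ h => Subtype.impEmbedding _ _ (F.isFace_iff.1 h)) e).r u v := by
  have hmem := fun w : closedBall (0 : Fin e.1 → ℝ) 1 =>
    closedFace_mono (F.face_subset e) (F.map_mem w.2)
  have hz := fun w : closedBall (0 : Fin e.1 → ℝ) 1 => closedFace_zero (F.map_mem (e := e) w.2)
  rw [Subtype.ext_iff]
  refine (polarPoint_ell_eq_iff hα hν (hmem u.2) (hmem v.2) (hz u.2) (hz v.2)).trans ?_
  constructor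
  · rintro ⟨h1, h2⟩
    refine ⟨Subtype.ext (F.injOn e u.2.2 v.2.2 h1), fun e' he hm m => h2 _ ?_⟩
    rw [F.openCell_eq] at hm
    exact (hm.1 m m.2).ne'
  · rintro ⟨h1, h2⟩
    refine ⟨by rw [h1], fun m hm => ?_⟩
    obtain ⟨e', he'⟩ := F.exists_cell _ (supp_subset (hmem u.2)) (supp_nonempty (hmem u.2))
    have hf : IsFace e' e := F.isFace_iff.2 (he' ▸ supp_subset (F.map_mem u.2.2))
    have hm' : (m : Fin n) ∈ F.face e' := he' ▸ mem_supp.2 hm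
    exact h2 e' hf (by rw [F.openCell_eq, he']; exact mem_openFace_supp (hmem u.2)) ⟨m, hm'⟩

/-- The attaching map of a cell, on the quotient by the collapse of the circle factors. -/
def toralAttachFun (F : FaceLabelling S C) (hα : ∀ j ∈ S, 0 < α * a j) (hν : α * ν < 0)
    (e : CWCells C) :
    Quotient (collapse (fun e => {m // m ∈ F.face e})
      (fun _ _ h => Subtype.impEmbedding _ _ (F.isFace_iff.1 h)) e) →
      closure (openToralCell a ν S (F.face e)) :=
  Quotient.lift (fun u => ⟨attachFun F hα hν e u, by
    have := mem_range_self (f := attachFun F hα hν e) u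
    rwa [range_attachFun, ← closure_openToralCell F hα hν] at this⟩)
    fun u v h => Subtype.ext ((attachFun_eq_iff F hα hν e u v).2 h)

lemma bijective_toralAttachFun (F : FaceLabelling S C) (hα : ∀ j ∈ S, 0 < α * a j)
    (hν : α * ν < 0) (e : CWCells C) : Function.Bijective (toralAttachFun F hα hν e) := by
  constructor
  · rintro ⟨u⟩ ⟨v⟩ h
    exact Quotient.sound ((attachFun_eq_iff F hα hν e u v).1 (Subtype.ext_iff.1 h))
  · rintro ⟨p, hp⟩
    have hp' := hp
    rw [closure_openToralCell F hα hν, ← range_attachFun F hα hν e] at hp'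
    obtain ⟨u, rfl⟩ := hp'
    exact ⟨Quotient.mk _ u, rfl⟩

/-- The attaching homeomorphism of a cell. -/
def toralAttach (F : FaceLabelling S C) (hα : ∀ j ∈ S, 0 < α * a j) (hν : α * ν < 0)
    (e : CWCells C) :
    Quotient (collapse (fun e => {m // m ∈ F.face e})
      (fun _ _ h => Subtype.impEmbedding _ _ (F.isFace_iff.1 h)) e) ≃ₜ
      closure (openToralCell a ν S (F.face e)) :=
  Continuous.homeoOfEquivCompactToT2
    (f := Equiv.ofBijective _ (bijective_toralAttachFun F hα hν e))
    (Continuous.quotient_lift (Continuous.subtype_mk (continuous_attachFun F hα hν e) _) _)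

/-- The ellipsoid is a toral CW complex over the closed face with labels `S`. -/
def toralComplex (F : FaceLabelling S C) (hα : ∀ j ∈ S, 0 < α * a j) (hν : α * ν < 0) :
    ToralCWComplex C (toralSet a ν S) where
  hausdorff := inferInstance
  finite_cells := F.finite_cells
  regular := F.injOn
  circ e := {m // m ∈ F.face e}
  finite_circ _ := inferInstance
  card_circ e := Or.inl (by rw [Nat.card_eq_fintype_card, Fintype.card_coe, F.card_face])
  incl _ _ h := Subtype.impEmbedding _ _ (F.isFace_iff.1 h)
  toralCell e := openToralCell a ν S (F.face e)
  disjoint_cells := fun e e' hne => Set.disjoint_left.2 fun p hp hp' =>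
    hne (F.face_injective (hp.symm.trans hp'))
  iUnion_cells := by
    refine eq_univ_of_forall fun p => mem_iUnion.2 ?_
    have h0 := ne_zero_of_mem_toralSet hν p.2
    have hd := direction_mem_closedFace h0 p.2.1
    obtain ⟨e, he⟩ := F.exists_cell _ (supp_subset hd) (supp_nonempty hd)
    exact ⟨e, by rw [he, supp_direction h0]; rfl⟩
  triv e := toralTriv hα hν (F.face_subset e) (F.openCell_eq e)
  attach e := toralAttach F hα hν e
  attach_boundary := by
    intro e s x hx
    have hmem := closedFace_mono (F.face_subset e) (F.map_mem x.2)
    obtain ⟨e', he'⟩ := F.exists_cell _ (supp_subset hmem) (supp_nonempty hmem)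
    refine ⟨e', ?_, (supp_attachFun F hα hν e (s, x)).trans he'.symm⟩
    have hlt := Finset.card_lt_card (F.supp_map_ssubset hx)
    rw [← he', F.card_face, F.card_face] at hlt
    simp only [Nat.card_eq_fintype_card, Fintype.card_coe, F.card_face]
    omega
  attach_interior := by
    intro e s x hx
    have hu := F.map_mem_openFace hx
    have hc := F.map_mem (e := e) x.2
    refine ⟨(supp_attachFun F hα hν e (s, x)).trans (supp_eq_of_mem_openFace hu), ?_, ?_⟩
    · exact funext fun m => phase_polarPoint hα hν s (closedFace_mono (F.face_subset e) hc)
        (closedFace_zero hc) m (hu.1 m m.2).ne'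
    · exact direction_polarPoint hα hν s (closedFace_mono (F.face_subset e) hc)
        (closedFace_zero hc)

end Attach

/-! ### The quotient model of the ellipsoid -/

lemma closure_spherePos {k : ℕ} (hk : 1 ≤ k) (hkn : k ≤ n) (σ : Equiv.Perm (Fin n)) :
    closure (spherePos n k σ) = closedFace (initialValues k σ) := by
  rw [spherePos_eq, closure_openFace]
  rw [← Finset.card_pos, card_initialValues hkn]
  omega

lemma label_iff {k : ℕ} {σ : Equiv.Perm (Fin n)} {m : Fin n} :
    (∃ i : Fin n, i.val < k ∧ σ i = m) ↔ m ∈ initialValues k σ := by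
  rw [mem_initialValues]
  exact ⟨by rintro ⟨i, hi, rfl⟩; simpa using hi, fun h => ⟨σ.symm m, h, by simp⟩⟩

section Quotient

variable {k : ℕ} {σ : Equiv.Perm (Fin n)}

lemma closedFace_zero_label {c : Fin n → ℝ} (hc : c ∈ closedFace (initialValues k σ)) :
    ∀ i, ¬ (∃ i' : Fin n, i'.val < k ∧ σ i' = i) → c i = 0 :=
  fun i hi => hc.2.1 i fun h => hi (label_iff.2 h)

/-- Polar coordinates on the ellipsoid, before the circle factors are collapsed. -/
def quotientFun (hk : 1 ≤ k) (hkn : k ≤ n) (hα : ∀ j ∈ initialValues k σ, 0 < α * a j)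
    (hν : α * ν < 0) (u : LabelledTorus n k σ × closure (spherePos n k σ)) :
    toralSet a ν (initialValues k σ) :=
  have hc : u.2.1 ∈ closedFace (initialValues k σ) := closure_spherePos hk hkn σ ▸ u.2.2
  ⟨polarPoint u.1 (ellRadius a ν u.2.1) u.2.1,
    polarPoint_mem_toralSet hα hν u.1 hc (closedFace_zero_label hc)⟩

lemma quotientFun_eq_iff (hk : 1 ≤ k) (hkn : k ≤ n)
    (hα : ∀ j ∈ initialValues k σ, 0 < α * a j)
    (hν : α * ν < 0) (u v : LabelledTorus n k σ × closure (spherePos n k σ)) :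
    quotientFun hk hkn hα hν u = quotientFun hk hkn hα hν v ↔ u.2 = v.2 ∧
      ∀ m : {m // ∃ i : Fin n, i.val < k ∧ σ i = m}, u.2.1 m ≠ 0 → u.1 m = v.1 m := by
  have hc : ∀ x : closure (spherePos n k σ), x.1 ∈ closedFace (initialValues k σ) :=
    fun x => closure_spherePos hk hkn σ ▸ x.2
  rw [Subtype.ext_iff]
  refine (polarPoint_ell_eq_iff hα hν (hc u.2) (hc v.2) (closedFace_zero_label (hc u.2))
    (closedFace_zero_label (hc v.2))).trans ?_
  rw [Subtype.ext_iff]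

lemma quotientFun_eq_of_rel (hk : 1 ≤ k) (hkn : k ≤ n)
    (hα : ∀ j ∈ initialValues k σ, 0 < α * a j)
    (hν : α * ν < 0) {u v : LabelledTorus n k σ × closure (spherePos n k σ)}
    (h : collapseRel n k σ u v) : quotientFun hk hkn hα hν u = quotientFun hk hkn hα hν v := by
  obtain ⟨h1, l, γ, -, -, -, hu, h2⟩ := h
  refine (quotientFun_eq_iff hk hkn hα hν u v).2 ⟨h1, fun m hm => ?_⟩
  obtain ⟨i, hi⟩ := γ.surjective m
  have hl : i.val < l := by
    by_contra! hle
    exact hm (hi ▸ hu.2.1 i hle)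
  have := h2 i (hi ▸ m.2) hl
  simpa only [hi] using this

/-- Points with the same polar coordinates have the same class: on the boundary they are identified
by the relation, and in the interior all angles agree. -/
lemma quot_eq_of_quotientFun_eq (hk : 1 ≤ k) (hkn : k ≤ n)
    (hα : ∀ j ∈ initialValues k σ, 0 < α * a j)
    (hν : α * ν < 0) {u v : LabelledTorus n k σ × closure (spherePos n k σ)}
    (h : quotientFun hk hkn hα hν u = quotientFun hk hkn hα hν v) :
    Quot.mk (collapseRel n k σ) u = Quot.mk (collapseRel n k σ) v := by
  obtain ⟨h1, h2⟩ := (quotientFun_eq_iff hk hkn hα hν u v).1 h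
  have hc : u.2.1 ∈ closedFace (initialValues k σ) := closure_spherePos hk hkn σ ▸ u.2.2
  by_cases hs : supp u.2.1 = initialValues k σ
  · congr 1
    refine Prod.ext (funext fun m => h2 m (mem_supp.1 ?_)) h1
    rw [hs]
    exact label_iff.1 m.2
  · obtain ⟨γ, hγ, hγs⟩ := exists_subShuffle hkn (A := supp u.2.1) rfl (supp_subset hc)
    have hlt := Finset.card_lt_card ((supp_subset hc).ssubset_of_ne hs)
    rw [card_initialValues hkn] at hlt
    refine Quot.sound ⟨h1, (supp u.2.1).card, γ, (supp_nonempty hc).card_pos, hlt, hγ, ?_,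
      fun i hi hil => h2 ⟨γ i, hi⟩ (mem_supp.1 ?_)⟩
    · rw [spherePos_eq, hγs]
      exact mem_openFace_supp hc
    · rw [← hγs]
      exact apply_mem_initialValues.2 hil

lemma continuous_quotientFun (hk : 1 ≤ k) (hkn : k ≤ n)
    (hα : ∀ j ∈ initialValues k σ, 0 < α * a j) (hν : α * ν < 0) :
    Continuous (quotientFun hk hkn hα hν) := by
  have hc : Continuous fun u : LabelledTorus n k σ × closure (spherePos n k σ) => u.2.1 :=
    continuous_subtype_val.comp continuous_snd
  exact Continuous.subtype_mk (continuous_polarPoint continuous_fst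
    (continuous_ellRadius hα hc fun u => closure_spherePos hk hkn σ ▸ u.2.2) hc) _

lemma quotientFun_surjective (hk : 1 ≤ k) (hkn : k ≤ n)
    (hα : ∀ j ∈ initialValues k σ, 0 < α * a j) (hν : α * ν < 0) :
    Function.Surjective (quotientFun hk hkn hα hν) := by
  intro p
  have h0 := ne_zero_of_mem_toralSet hν p.2
  refine ⟨(fun m => phase p.1 m, ⟨direction p.1, ?_⟩), Subtype.ext ?_⟩
  · rw [closure_spherePos hk hkn]
    exact direction_mem_closedFace h0 p.2.1
  · exact polarPoint_ell_phase hα hν p.2 fun i hi =>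
      radius_eq_zero.2 (p.2.1 i fun h => hi (label_iff.2 h))

lemma compactSpace_toralQuotient (hk : 1 ≤ k) (hkn : k ≤ n) (σ : Equiv.Perm (Fin n)) :
    CompactSpace (ToralQuotient n k σ) := by
  have : CompactSpace (closure (spherePos n k σ)) := by
    rw [closure_spherePos hk hkn]
    exact isCompact_iff_compactSpace.1 (isCompact_closedFace _)
  exact Quot.compactSpace

/-- The quotient model is homeomorphic to the ellipsoid, by polar coordinates. -/
lemma exists_quotient_homeomorph (hk : 1 ≤ k) (hkn : k ≤ n)
    (hα : ∀ j ∈ initialValues k σ, 0 < α * a j) (hν : α * ν < 0) :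
    ∃ H : ToralQuotient n k σ ≃ₜ toralSet a ν (initialValues k σ),
      ∀ u, H (Quot.mk _ u) = quotientFun hk hkn hα hν u := by
  have := compactSpace_toralQuotient hk hkn σ
  let f : ToralQuotient n k σ → toralSet a ν (initialValues k σ) :=
    Quot.lift (quotientFun hk hkn hα hν) fun _ _ => quotientFun_eq_of_rel hk hkn hα hν
  have hf : Function.Bijective f := by
    constructor
    · rintro ⟨u⟩ ⟨v⟩ h
      exact quot_eq_of_quotientFun_eq hk hkn hα hν h
    · intro p
      obtain ⟨u, rfl⟩ := quotientFun_surjective hk hkn hα hν p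
      exact ⟨Quot.mk _ u, rfl⟩
  exact ⟨Continuous.homeoOfEquivCompactToT2 (f := Equiv.ofBijective f hf)
    (continuous_quot_lift _ (continuous_quotientFun hk hkn hα hν)), fun _ => rfl⟩

lemma quotientFun_mem_leaf (hk : 1 ≤ k) (hkn : k ≤ n)
    (hα : ∀ j ∈ initialValues k σ, 0 < α * a j) (hν : α * ν < 0) {l : ℕ}
    {γ : Equiv.Perm (Fin n)} (u : LabelledTorus n k σ × closure (spherePos n k σ))
    (hu : u.2.1 ∈ spherePos n l γ) : (quotientFun hk hkn hα hν u).1 ∈ leaf n l γ u.2.1 := by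
  have hc : u.2.1 ∈ closedFace (initialValues k σ) := closure_spherePos hk hkn σ ▸ u.2.2
  refine ⟨mem_stateCell.2 ?_, direction_polarPoint hα hν u.1 hc (closedFace_zero_label hc)⟩
  rw [spherePos_eq] at hu
  exact (supp_polarPoint hα hν u.1 hc (closedFace_zero_label hc)).trans
    (supp_eq_of_mem_openFace hu)

/-- The quotient has two different points, since its base has. -/
lemma nontrivial_toralQuotient (hk : 2 ≤ k) (hkn : k ≤ n) (σ : Equiv.Perm (Fin n)) :
    Nontrivial (ToralQuotient n k σ) := by
  have hm : ∀ m ∈ initialValues k σ, ∃ c ∈ closedFace (initialValues k σ), supp c = {m} := by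
    intro m hm
    obtain ⟨c, hc⟩ := openFace_nonempty (Finset.singleton_nonempty m)
    exact ⟨c, openFace_subset_closedFace (Finset.singleton_subset_iff.2 hm) hc,
      supp_eq_of_mem_openFace hc⟩
  obtain ⟨c, hc, hcs⟩ := hm (σ ⟨0, by omega⟩) (apply_mem_initialValues.2 (by simp; omega))
  obtain ⟨d, hd, hds⟩ := hm (σ ⟨1, by omega⟩) (apply_mem_initialValues.2 (by simp; omega))
  rw [← closure_spherePos (by omega) hkn] at hc hd
  refine ⟨Quot.mk _ (1, ⟨c, hc⟩), Quot.mk _ (1, ⟨d, hd⟩), fun h => ?_⟩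
  have h2 := congrArg (Quot.lift (fun u => u.2) fun _ _ h => h.1 :
    ToralQuotient n k σ → closure (spherePos n k σ)) h
  have h3 : c = d := congrArg Subtype.val h2
  rw [h3, hds, Finset.singleton_inj] at hcs
  simpa using σ.injective hcs

end Quotient

end ToralComplex

/-! ### Invariance -/

section Dynamics

variable {n : ℕ} {S : Finset (Fin n)} {a ω : Fin n → ℝ} {α ν : ℝ}

/-- The closed cell is a coordinate subspace. -/
lemma closure_stateCell (k : ℕ) (σ : Equiv.Perm (Fin n)) :
    closure (stateCell n k σ) = coordPlane (initialValues k σ) := by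
  refine Subset.antisymm (closure_minimal (fun p hp =>
    mem_coordPlane.2 (mem_stateCell.1 hp).subset) (isClosed_coordPlane _)) fun p hp => ?_
  -- the vanishing planes with labels in `S` are perturbed
  have hc : Continuous fun ε : ℝ => ((fun i => if i ∈ initialValues k σ ∧ radius p i = 0 then ε
      else p.1 i, p.2) : State n) := by
    refine Continuous.prodMk (continuous_pi fun i => ?_) continuous_const
    split_ifs
    · exact continuous_id
    · exact continuous_const
  have hlim := (hc.tendsto 0).mono_left (nhdsWithin_le_nhds (s := Ioi 0))
  have h0 : ((fun i => if i ∈ initialValues k σ ∧ radius p i = 0 then (0 : ℝ)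
      else p.1 i, p.2) : State n) = p := by
    refine Prod.ext (funext fun i => ?_) rfl
    simp only
    split_ifs with h
    · exact (radius_eq_zero.1 h.2).1.symm
    · rfl
  rw [h0] at hlim
  refine mem_closure_of_tendsto hlim ?_
  filter_upwards [self_mem_nhdsWithin] with ε hε
  rw [mem_stateCell]
  ext i
  rw [mem_supp, ne_eq, radius_eq_zero]
  by_cases hi : i ∈ initialValues k σ
  · simp only [hi, true_and, iff_true]
    rintro ⟨h1, h2⟩
    split_ifs at h1 with h
    · exact (ne_of_gt hε) h1
    · exact h (radius_eq_zero.2 ⟨h1, h2⟩)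
  · simp [hi, hp i hi]

lemma spiral_mem_coordPlane {p : State n} (hp : p ∈ coordPlane S) (lam t : ℝ) :
    spiral ω lam t p ∈ coordPlane S := fun i hi => by
  simp [spiral, hp i hi]

lemma supp_radius_spiral {lam : ℝ} (hlam : 0 < lam) (t : ℝ) (p : State n) :
    supp (radius (spiral ω lam t p)) = supp (radius p) := by
  ext i
  rw [mem_supp, mem_supp, radius_spiral ω hlam.le, mul_ne_zero_iff, and_iff_right hlam.ne']

lemma direction_spiral {lam : ℝ} (hlam : 0 < lam) (t : ℝ) (p : State n) :
    direction (spiral ω lam t p) = direction p := by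
  ext i
  simp only [direction, radius_spiral ω hlam.le, mul_pow, ← Finset.mul_sum]
  rw [Real.sqrt_mul (sq_nonneg _), Real.sqrt_sq hlam.le, mul_div_mul_left _ _ hlam.ne']

lemma spiral_mem_leaf {l : ℕ} {γ : Equiv.Perm (Fin n)} {C : Fin n → ℝ} {p : State n}
    (hp : p ∈ leaf n l γ C) {lam : ℝ} (hlam : 0 < lam) (t : ℝ) :
    spiral ω lam t p ∈ leaf n l γ C :=
  ⟨mem_stateCell.2 ((supp_radius_spiral hlam t p).trans (mem_stateCell.1 hp.1)),
    (direction_spiral hlam t p).trans hp.2⟩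

lemma isFlowInvariant_leaf (l : ℕ) (γ : Equiv.Perm (Fin n)) (C : Fin n → ℝ) :
    IsFlowInvariant (eulerField ω a ν) (leaf n l γ C) := by
  intro x J hJ h0 hx hx0 t ht
  obtain ⟨lam, hlam, h⟩ := hx.exists_eq_spiral hJ h0 ht
  rw [h]
  exact spiral_mem_leaf hx0 hlam t

lemma isFlowInvariant_coordPlane (S : Finset (Fin n)) :
    IsFlowInvariant (eulerField ω a ν) (coordPlane S) := by
  intro x J hJ h0 hx hx0 t ht
  obtain ⟨lam, hlam, h⟩ := hx.exists_eq_spiral hJ h0 ht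
  rw [h]
  exact spiral_mem_coordPlane hx0 _ _

lemma IsFlowInvariant.inter {E : Type*} [NormedAddCommGroup E] [NormedSpace ℝ E] {V : E → E}
    {A B : Set E} (hA : IsFlowInvariant V A) (hB : IsFlowInvariant V B) :
    IsFlowInvariant V (A ∩ B) := fun x J hJ h0 hx hx0 t ht =>
  ⟨hA x J hJ h0 hx hx0.1 t ht, hB x J hJ h0 hx hx0.2 t ht⟩

/-- The function `ν + ∑ a_j ρ_j²`, which vanishes on the ellipsoid, along a solution. -/
lemma add_quad_spiral (hν : ν ≠ 0) {p : State n} {t : ℝ} (hw : 0 < scaling a ν p t) :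
    ν + quad a (spiral ω (√(scaling a ν p t))⁻¹ t p) =
      (ν + quad a p) * (Real.exp (-2 * ν * t) / scaling a ν p t) := by
  rw [quad_spiral, inv_pow, Real.sq_sqrt hw.le, ← mul_div_assoc, eq_div_iff hw.ne', add_mul,
    mul_right_comm, inv_mul_cancel₀ hw.ne', scaling]
  field_simp
  ring

lemma isFlowInvariant_toralSet (hν : α * ν < 0) :
    IsFlowInvariant (eulerField ω a ν) (toralSet a ν S) := by
  intro x J hJ h0 hx hx0 t ht
  have hν0 : ν ≠ 0 := by rintro rfl; simp at hν
  obtain ⟨h1, h2⟩ := hx.eq_spiral hJ h0 (ne_zero_of_mem_toralSet hν hx0)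
    (isScaling_scaling a hν0 _) ht
  refine ⟨isFlowInvariant_coordPlane S x J hJ h0 hx hx0.1 t ht, ?_⟩
  rw [h2, add_quad_spiral hν0 h1, hx0.2, zero_mul]

/-- The part of the ellipsoid in a leaf is a Clifford torus. -/
lemma toralSet_inter_leaf (hα : ∀ j ∈ S, 0 < α * a j) (hν : α * ν < 0) {l : ℕ}
    {γ : Equiv.Perm (Fin n)} (hγ : initialValues l γ ⊆ S) {C : Fin n → ℝ}
    (hC : C ∈ spherePos n l γ) :
    toralSet a ν S ∩ leaf n l γ C = {p | ∀ i, radius p i = ellRadius a ν C * C i} := by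
  rw [spherePos_eq] at hC
  have hCS : C ∈ closedFace S := openFace_subset_closedFace hγ hC
  have hr := ellRadius_pos hα hν hCS
  ext p
  constructor
  · rintro ⟨hp, -, rfl⟩ i
    rw [ellRadius_direction hα hν hp, stateNorm_mul_direction (ne_zero_of_mem_toralSet hν hp)]
  · intro hp
    refine ⟨⟨fun i hi => radius_eq_zero.1 (by rw [hp, hCS.2.1 i hi, mul_zero]), ?_⟩,
      mem_stateCell.2 ?_, direction_eq hC.2.2 hr hp⟩
    · rw [quad_eq_of_radius a hp, ellRadius_sq hα hν hCS, add_neg_cancel]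
    · rw [← supp_eq_of_mem_openFace hC]
      ext i
      rw [mem_supp, mem_supp, hp, mul_ne_zero_iff, and_iff_right hr.ne']

/-! ### Compactness -/

/-- On the subspace with labels `S` the norm is controlled by the form `∑ a_j ρ_j²`. -/
lemma norm_le_of_mem_coordPlane (hα : ∀ j ∈ S, 0 < α * a j) {p : State n}
    (hp : p ∈ coordPlane S) : ‖p‖ ≤ √((∑ j ∈ S, (α * a j)⁻¹) * (α * quad a p)) := by
  have hterm : ∀ j, 0 ≤ α * a j * (p.1 j ^ 2 + p.2 j ^ 2) := fun j => by
    by_cases hj : j ∈ S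
    · have := hα j hj
      positivity
    · simp [hp j hj]
  have key : ∀ i, p.1 i ^ 2 + p.2 i ^ 2 ≤ (∑ j ∈ S, (α * a j)⁻¹) * (α * quad a p) := by
    intro i
    by_cases hi : i ∈ S
    · have h1 : α * a i * (p.1 i ^ 2 + p.2 i ^ 2) ≤ α * quad a p := by
        rw [quad, Finset.mul_sum]
        simp only [← mul_assoc]
        exact Finset.single_le_sum (f := fun j => α * a j * (p.1 j ^ 2 + p.2 j ^ 2))
          (fun j _ => hterm j) (Finset.mem_univ i)
      have h2 : (α * a i)⁻¹ ≤ ∑ j ∈ S, (α * a j)⁻¹ :=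
        Finset.single_le_sum (f := fun j => (α * a j)⁻¹) (fun j hj => (inv_pos.2 (hα j hj)).le) hi
      calc p.1 i ^ 2 + p.2 i ^ 2 = (α * a i)⁻¹ * (α * a i * (p.1 i ^ 2 + p.2 i ^ 2)) := by
            rw [inv_mul_cancel_left₀ (hα i hi).ne']
        _ ≤ (α * a i)⁻¹ * (α * quad a p) :=
            mul_le_mul_of_nonneg_left h1 (inv_pos.2 (hα i hi)).le
        _ ≤ _ := mul_le_mul_of_nonneg_right h2 (mul_quad_nonneg hα hp)
    · have : 0 ≤ ∑ j ∈ S, (α * a j)⁻¹ := Finset.sum_nonneg fun j hj => (inv_pos.2 (hα j hj)).le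
      have h2 := mul_nonneg this (mul_quad_nonneg hα hp)
      simpa [hp i hi] using h2
  rw [Prod.norm_def, sup_le_iff, pi_norm_le_iff_of_nonneg (Real.sqrt_nonneg _),
    pi_norm_le_iff_of_nonneg (Real.sqrt_nonneg _)]
  exact ⟨fun i => Real.abs_le_sqrt (by nlinarith [key i, sq_nonneg (p.2 i)]),
    fun i => Real.abs_le_sqrt (by nlinarith [key i, sq_nonneg (p.1 i)])⟩

lemma eventually_toralSet_subset (hα : ∀ j ∈ S, 0 < α * a j) {U : Set (State n)}
    (hU : U ∈ 𝓝 (0 : State n)) : ∀ᶠ ν in 𝓝 (0 : ℝ), toralSet a ν S ⊆ U := by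
  obtain ⟨ε, hε, hb⟩ := Metric.mem_nhds_iff.1 hU
  have hc : Continuous fun ν : ℝ => √((∑ j ∈ S, (α * a j)⁻¹) * (α * -ν)) := by fun_prop
  have : ∀ᶠ ν in 𝓝 (0 : ℝ), √((∑ j ∈ S, (α * a j)⁻¹) * (α * -ν)) < ε :=
    (hc.tendsto 0).eventually (by simpa using gt_mem_nhds hε)
  filter_upwards [this] with ν hν p hp
  refine hb (mem_ball_zero_iff.2 ((norm_le_of_mem_coordPlane hα hp.1).trans_lt ?_))
  rwa [show quad a p = -ν by linarith [hp.2]]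

/-- The sets `|ν + ∑ a_j ρ_j²| < ε` are a neighbourhood base of the ellipsoid in the subspace with
labels `S`. -/
lemma exists_pos_forall_mem (hα : ∀ j ∈ S, 0 < α * a j) {U : Set (State n)}
    (hU : U ∈ 𝓝ˢ (toralSet a ν S)) :
    ∃ ε > 0, ∀ p ∈ coordPlane S, |ν + quad a p| < ε → p ∈ U := by
  obtain ⟨V, hV, hXV, hVU⟩ := mem_nhdsSet_iff_exists.1 hU
  have hcont : Continuous fun p : State n => |ν + quad a p| :=
    (continuous_const.add (continuous_quad a)).abs
  have hclosed : IsClosed {p : State n | p ∈ coordPlane S ∧ |ν + quad a p| ≤ 1} :=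
    (isClosed_coordPlane S).inter (isClosed_le hcont continuous_const)
  have hcomp : IsCompact ({p : State n | p ∈ coordPlane S ∧ |ν + quad a p| ≤ 1} \ V) := by
    refine (Metric.isCompact_of_isClosed_isBounded hclosed ?_).diff hV
    refine (isBounded_closedBall (x := (0 : State n))
      (r := √((∑ j ∈ S, (α * a j)⁻¹) * (|α| * (1 + |ν|))))).subset fun p hp => ?_
    rw [mem_closedBall_zero_iff]
    refine (norm_le_of_mem_coordPlane hα hp.1).trans (Real.sqrt_le_sqrt
      (mul_le_mul_of_nonneg_left ?_ (Finset.sum_nonneg fun j hj => (inv_pos.2 (hα j hj)).le)))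
    refine (le_abs_self _).trans ((abs_mul _ _).trans_le
      (mul_le_mul_of_nonneg_left ?_ (abs_nonneg _)))
    calc |quad a p| = |(ν + quad a p) - ν| := by ring_nf
      _ ≤ |ν + quad a p| + |ν| := abs_sub _ _
      _ ≤ 1 + |ν| := by linarith [hp.2]
  rcases eq_empty_or_nonempty ({p : State n | p ∈ coordPlane S ∧ |ν + quad a p| ≤ 1} \ V)
    with he | hne
  · refine ⟨1, one_pos, fun p hp h => hVU (by_contra fun hpV => ?_)⟩
    exact he.subset ⟨⟨hp, h.le⟩, hpV⟩
  · obtain ⟨m, hm, hmin⟩ := hcomp.exists_isMinOn hne hcont.continuousOn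
    have hpos : 0 < |ν + quad a m| :=
      abs_pos.2 fun h => hm.2 (hXV ⟨hm.1.1, h⟩)
    refine ⟨min 1 |ν + quad a m|, lt_min one_pos hpos, fun p hp h => hVU
      (by_contra fun hpV => ?_)⟩
    have := hmin ⟨⟨hp, (h.trans_le (min_le_left _ _)).le⟩, hpV⟩
    exact (h.trans_le (min_le_right _ _)).not_ge this

lemma abs_add_quad_lt_mem_nhdsSet {ε : ℝ} (hε : 0 < ε) :
    {p : State n | |ν + quad a p| < ε} ∈ 𝓝ˢ (toralSet a ν S) := by
  have hopen : IsOpen {p : State n | |ν + quad a p| < ε} :=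
    isOpen_lt (continuous_const.add (continuous_quad a)).abs continuous_const
  refine hopen.mem_nhdsSet.2 fun p hp => ?_
  rw [mem_ofPred_eq, hp.2, abs_zero]
  exact hε

end Dynamics

/-! ### Stability -/

section Stability

variable {n : ℕ} {S : Finset (Fin n)} {a ω : Fin n → ℝ} {α ν : ℝ}

lemma neg_quad_div_nonneg (hα : ∀ j ∈ S, 0 < α * a j) (hν : α * ν < 0) {p : State n}
    (hp : p ∈ coordPlane S) : 0 ≤ -quad a p / ν := by
  have hα0 : α ≠ 0 := by rintro rfl; simp at hν
  rw [← mul_div_mul_left _ _ hα0]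
  exact div_nonneg_of_nonpos (by linarith [mul_quad_nonneg hα hp]) hν.le

lemma neg_quad_div_pos (hα : ∀ j ∈ S, 0 < α * a j) (hν : α * ν < 0) {p : State n}
    (hp : p ∈ coordPlane S) (h0 : p ≠ 0) : 0 < -quad a p / ν := by
  have hα0 : α ≠ 0 := by rintro rfl; simp at hν
  rw [← mul_div_mul_left _ _ hα0]
  exact div_pos_of_neg_of_neg (by linarith [mul_quad_pos hα hp h0]) hν

/-- In the time direction given by the sign of `ν` the scaling stays positive. -/
lemma exp_le_scaling (hα : ∀ j ∈ S, 0 < α * a j) (hν : α * ν < 0) {p : State n}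
    (hp : p ∈ coordPlane S) {t : ℝ} (ht : 0 ≤ ν * t) :
    Real.exp (-2 * ν * t) ≤ scaling a ν p t := by
  have h1 : Real.exp (-2 * ν * t) ≤ 1 := Real.exp_le_one_iff.2 (by linarith)
  have := mul_nonneg (neg_quad_div_nonneg hα hν hp) (sub_nonneg.2 h1)
  rw [scaling]
  linarith

lemma exists_solution (hα : ∀ j ∈ S, 0 < α * a j) (hν : α * ν < 0) {p : State n}
    (hp : p ∈ coordPlane S) {J : Set ℝ} (hJ : ∀ t ∈ J, 0 ≤ ν * t) :
    ∃ x : ℝ → State n, Solves (eulerField ω a ν) x J ∧ x 0 = p := by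
  have hν0 : ν ≠ 0 := by rintro rfl; simp at hν
  have hw := isScaling_scaling a hν0 p
  exact ⟨_, hw.solves fun t ht => (Real.exp_pos _).trans_le (exp_le_scaling hα hν hp (hJ t ht)),
    hw.spiral_zero⟩

/-- In the time direction given by the sign of `ν` solutions do not move away from the ellipsoid. -/
lemma abs_add_quad_le (hα : ∀ j ∈ S, 0 < α * a j) (hν : α * ν < 0) {x : ℝ → State n}
    {J : Set ℝ} (hJ : J.OrdConnected) (h0 : (0 : ℝ) ∈ J) (hx : Solves (eulerField ω a ν) x J)
    (hp : x 0 ∈ coordPlane S) {t : ℝ} (ht : t ∈ J) (hνt : 0 ≤ ν * t) :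
    |ν + quad a (x t)| ≤ |ν + quad a (x 0)| := by
  by_cases hx0 : x 0 = 0
  · rw [hx.eq_zero hJ h0 hx0 ht, hx0]
  have hν0 : ν ≠ 0 := by rintro rfl; simp at hν
  obtain ⟨h1, h2⟩ := hx.eq_spiral hJ h0 hx0 (isScaling_scaling a hν0 _) ht
  rw [h2, add_quad_spiral hν0 h1, abs_mul, abs_of_nonneg (div_nonneg (Real.exp_pos _).le h1.le)]
  exact mul_le_of_le_one_right (abs_nonneg _) ((div_le_one h1).2 (exp_le_scaling hα hν hp hνt))

/-- Solutions converge to the ellipsoid in every limit of time in which `exp (-2νt)` tends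
to `0`. -/
lemma convergesToSet_toralSet (hα : ∀ j ∈ S, 0 < α * a j) (hν : α * ν < 0) {x : ℝ → State n}
    {J : Set ℝ} (hJ : J.OrdConnected) (h0 : (0 : ℝ) ∈ J) (hx : Solves (eulerField ω a ν) x J)
    (hp : x 0 ∈ coordPlane S) (hx0 : x 0 ≠ 0) {l : Filter ℝ} (hl : ∀ᶠ t in l, t ∈ J)
    (hlim : Tendsto (fun t => Real.exp (-2 * ν * t)) l (𝓝 0)) :
    ConvergesToSet x l (toralSet a ν S) := by
  intro U hU
  obtain ⟨ε, hε, hεU⟩ := exists_pos_forall_mem hα hU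
  have hν0 : ν ≠ 0 := by rintro rfl; simp at hν
  have hy := neg_quad_div_pos hα hν hp hx0
  have hw : Tendsto (scaling a ν (x 0)) l (𝓝 (-quad a (x 0) / ν)) := by
    have := hlim.add ((hlim.const_sub 1).const_mul (-quad a (x 0) / ν))
    rwa [sub_zero, mul_one, zero_add] at this
  have hdev : Tendsto (fun t => |(ν + quad a (x 0)) *
      (Real.exp (-2 * ν * t) / scaling a ν (x 0) t)|) l (𝓝 0) := by
    simpa using ((hlim.div hw hy.ne').const_mul (ν + quad a (x 0))).abs
  filter_upwards [hl, hdev.eventually (gt_mem_nhds hε)] with t ht htε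
  refine hεU _ (isFlowInvariant_coordPlane S x J hJ h0 hx hp t ht) ?_
  obtain ⟨h1, h2⟩ := hx.eq_spiral hJ h0 hx0 (isScaling_scaling a hν0 _) ht
  rwa [h2, add_quad_spiral hν0 h1]

lemma tendsto_exp_atTop (hν : 0 < ν) :
    Tendsto (fun t => Real.exp (-2 * ν * t)) atTop (𝓝 0) :=
  Real.tendsto_exp_atBot.comp (tendsto_id.const_mul_atTop_of_neg (by linarith))

lemma tendsto_exp_atBot (hν : ν < 0) :
    Tendsto (fun t => Real.exp (-2 * ν * t)) atBot (𝓝 0) :=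
  Real.tendsto_exp_atBot.comp (tendsto_id.const_mul_atBot (by linarith))

lemma asymptoticallyStableOn_toralSet (hα : ∀ j ∈ S, 0 < α * a j) (hν : α * ν < 0)
    (hα0 : α < 0) :
    AsymptoticallyStableOn (eulerField ω a ν) (coordPlane S) (toralSet a ν S) := by
  have hνpos : 0 < ν := pos_of_mul_neg_right hν hα0.le
  constructor
  · intro U hU
    obtain ⟨ε, hε, hεU⟩ := exists_pos_forall_mem hα hU
    refine ⟨_, abs_add_quad_lt_mem_nhdsSet hε, fun x T hx hx0 t ht => ?_⟩
    have h0 : (0 : ℝ) ∈ Icc 0 T := ⟨le_rfl, ht.1.trans ht.2⟩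
    exact hεU _ (isFlowInvariant_coordPlane S x _ ordConnected_Icc h0 hx hx0.2 t ht)
      ((abs_add_quad_le hα hν ordConnected_Icc h0 hx hx0.2 ht
        (mul_nonneg hνpos.le ht.1)).trans_lt hx0.1)
  · refine ⟨_, abs_add_quad_lt_mem_nhdsSet hνpos, fun p hp => ?_⟩
    refine ⟨exists_solution hα hν hp.2 fun t ht => mul_nonneg hνpos.le ht, ?_⟩
    rintro x hx rfl
    refine convergesToSet_toralSet hα hν ordConnected_Ici self_mem_Ici hx hp.2 (fun h0 => ?_)
      (eventually_ge_atTop 0) (tendsto_exp_atTop hνpos)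
    have := hp.1
    rw [mem_ofPred_eq, h0, quad_zero, add_zero, abs_of_pos hνpos] at this
    exact this.false

/-- A solution leaves the neighbourhood `|ν + ∑ a_j ρ_j²| < |ν| / 2` of the ellipsoid at the time at
which `exp (-2νt) = M`, for a suitable `M`. -/
lemma exists_escape (hν : ν < 0) {p : State n} {M : ℝ} (hM : 1 ≤ M)
    (hpos : ∀ E ∈ Icc 1 M, 0 < E + -quad a p / ν * (1 - E))
    (hesc : M + -quad a p / ν * (1 - M) ≤ 2 * |1 - -quad a p / ν| * M) :
    ∃ (T : ℝ) (x : ℝ → State n), 0 ≤ T ∧ Solves (eulerField ω a ν) x (Icc 0 T) ∧ x 0 = p ∧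
      x T ∉ {q : State n | |ν + quad a q| < |ν| / 2} := by
  have hw := isScaling_scaling a hν.ne p
  have hT : 0 ≤ Real.log M / (-2 * ν) := div_nonneg (Real.log_nonneg hM) (by linarith)
  have hexp : Real.exp (-2 * ν * (Real.log M / (-2 * ν))) = M := by
    rw [mul_div_cancel₀ _ (by linarith : -2 * ν ≠ 0), Real.exp_log (by linarith)]
  have hwpos : ∀ t ∈ Icc 0 (Real.log M / (-2 * ν)), 0 < scaling a ν p t := fun t ht =>
    hpos _ ⟨Real.one_le_exp (mul_nonneg (by linarith) ht.1), by
      conv_rhs => rw [← hexp]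
      exact Real.exp_le_exp.2 (mul_le_mul_of_nonneg_left ht.2 (by linarith))⟩
  refine ⟨_, _, hT, hw.solves hwpos, hw.spiral_zero, ?_⟩
  have h1 := hwpos _ (right_mem_Icc.2 hT)
  rw [mem_ofPred_eq, not_lt, add_quad_spiral hν.ne h1]
  have h2 : scaling a ν p (Real.log M / (-2 * ν)) = M + -quad a p / ν * (1 - M) := by
    rw [scaling, hexp]
  have h3 : ν + quad a p = ν * (1 - -quad a p / ν) := by
    field_simp [hν.ne]
    ring
  rw [hexp, abs_mul, h3, abs_mul, abs_of_pos (div_pos (by linarith) h1), mul_assoc, div_eq_mul_inv]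
  refine mul_le_mul_of_nonneg_left ?_ (abs_nonneg _)
  rw [← mul_div_assoc, le_div_iff₀ h1, h2]
  linarith

/-- If `α > 0`, every point off the ellipsoid leaves a fixed neighbourhood of it in forward time. -/
lemma escape_of_notMem (hα : ∀ j ∈ S, 0 < α * a j) (hν : α * ν < 0) (hα0 : 0 < α)
    {p : State n} (hp : p ∈ coordPlane S) (hpX : p ∉ toralSet a ν S) :
    ∃ (T : ℝ) (x : ℝ → State n), 0 ≤ T ∧ Solves (eulerField ω a ν) x (Icc 0 T) ∧ x 0 = p ∧
      x T ∉ {q : State n | |ν + quad a q| < |ν| / 2} := by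
  have hνneg : ν < 0 := neg_of_mul_neg_right hν hα0.le
  have hy := neg_quad_div_nonneg hα hν hp
  have hy1 : -quad a p / ν ≠ 1 := fun h => hpX ⟨hp, by
    rw [div_eq_one_iff_eq hνneg.ne] at h
    linarith⟩
  set y := -quad a p / ν with hydef
  rcases lt_or_gt_of_ne hy1 with h | h
  -- inside the ellipsoid: the radii shrink by the factor `(1 + y)^{-1/2}` until the exit
  · have h1 : 0 < 1 - y := by linarith
    have hM : 1 ≤ (1 - y)⁻¹ := (one_le_inv₀ h1).2 (by linarith)
    have hM1 : (1 - y) * (1 - y)⁻¹ = 1 := mul_inv_cancel₀ h1.ne'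
    refine exists_escape hνneg hM (fun E hE => ?_) ?_
    · nlinarith [mul_nonneg h1.le (sub_nonneg.2 hE.1)]
    · rw [← hydef, abs_of_pos h1]
      nlinarith
  -- outside the ellipsoid: either the point is far enough, or it is when `3 (y - 1) E = y`
  · have h1 : 0 < y - 1 := by linarith
    have habs : |1 - y| = y - 1 := by rw [abs_sub_comm, abs_of_pos h1]
    rcases le_total y (3 * (y - 1)) with h3 | h3
    · refine exists_escape hνneg le_rfl (fun E hE => ?_) ?_
      · have : E = 1 := le_antisymm hE.2 hE.1
        simp [this]
      · rw [← hydef, habs]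
        linarith
    · have hM1 : 3 * ((y - 1) * (y / (3 * (y - 1)))) = y := by field_simp
      refine exists_escape hνneg ((one_le_div (by linarith)).2 h3) (fun E hE => ?_) ?_
      · have := mul_le_mul_of_nonneg_left hE.2 h1.le
        rw [← hydef]
        linarith
      · rw [← hydef, habs]
        linarith

lemma toralSet_nonempty (hα : ∀ j ∈ S, 0 < α * a j) (hν : α * ν < 0) {A : Finset (Fin n)}
    (hA : A.Nonempty) (hAS : A ⊆ S) : ∃ p ∈ toralSet a ν S, supp (radius p) = A := by
  obtain ⟨c, hc⟩ := openFace_nonempty hA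
  have hcA := openFace_subset_closedFace subset_rfl hc
  have hcS := closedFace_mono hAS hcA
  exact ⟨_, polarPoint_mem_toralSet hα hν (1 : {m // m ∈ A} → Circle) hcS (closedFace_zero hcA),
    (supp_polarPoint hα hν _ hcS (closedFace_zero hcA)).trans (supp_eq_of_mem_openFace hc)⟩

lemma not_lyapunovStableOn_toralSet (hα : ∀ j ∈ S, 0 < α * a j) (hν : α * ν < 0) (hα0 : 0 < α)
    (hS : S.Nonempty) :
    ¬ LyapunovStableOn (eulerField ω a ν) (coordPlane S) (toralSet a ν S) := by
  intro h
  have hν0 : ν ≠ 0 := by rintro rfl; simp at hν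
  obtain ⟨W, hW, hWU⟩ := h _ (abs_add_quad_lt_mem_nhdsSet (half_pos (abs_pos.2 hν0)))
  obtain ⟨p, hp, -⟩ := toralSet_nonempty hα hν hS subset_rfl
  -- dilations of a point of the ellipsoid start arbitrarily close to it
  have hc : Continuous fun δ : ℝ => spiral ω (1 + δ) 0 p := by
    unfold spiral
    fun_prop
  have hlim := (hc.tendsto 0).mono_left (nhdsWithin_le_nhds (s := Ioi 0))
  rw [add_zero, spiral_one_zero] at hlim
  obtain ⟨δ, hδW, hδ⟩ :=
    ((hlim.eventually (mem_nhdsSet_iff_forall.1 hW p hp)).and self_mem_nhdsWithin).exists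
  have hδ0 : 0 < δ := hδ
  have hmem : spiral ω (1 + δ) 0 p ∈ coordPlane S := spiral_mem_coordPlane hp.1 _ _
  obtain ⟨T, x, hT, hx, hx0, hxT⟩ := escape_of_notMem (ω := ω) hα hν hα0 hmem (fun hX => by
    have h1 := hX.2
    rw [quad_spiral, show quad a p = -ν by linarith [hp.2]] at h1
    have h2 : ν * (δ * (2 + δ)) = 0 := by linarith
    have : δ * (2 + δ) ≠ 0 := by positivity
    exact (mul_ne_zero hν0 this) h2)
  exact hxT (hWU x T hx (by rw [hx0]; exact ⟨hδW, hmem⟩) T (right_mem_Icc.2 hT))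

/-! ### Nonexistence and bifurcation -/

/-- If `α ν ≥ 0`, a compact flow-invariant set in the subspace consists at most of the origin: the
norm would have a maximum on it, but it is strictly monotone along solutions. -/
lemma subset_zero_of_isFlowInvariant (hα : ∀ j ∈ S, 0 < α * a j) (hν : 0 ≤ α * ν)
    {X : Set (State n)} (hX : IsCompact X) (hXS : X ⊆ coordPlane S)
    (hinv : IsFlowInvariant (eulerField ω a ν) X) : X ⊆ {0} := by
  intro p hp
  by_contra hp0
  obtain ⟨m, hm, hmax⟩ := hX.exists_isMaxOn ⟨p, hp⟩ (continuous_quad 1).continuousOn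
  have hmpos : 0 < quad 1 m := (quad_one_pos hp0).trans_le (hmax hp)
  have hm0 : m ≠ 0 := by
    rintro rfl
    simp [quad_zero] at hmpos
  obtain ⟨ε, hε, x, hx, rfl⟩ := exists_local_solution ω a ν m
  have h0 : (0 : ℝ) ∈ Ioo (-ε) ε := ⟨by linarith, hε⟩
  have hnhds : Ioo (-ε) ε ∈ 𝓝 (0 : ℝ) := isOpen_Ioo.mem_nhds h0
  have hmaxl : IsLocalMax (fun t => quad 1 (x t)) 0 := by
    filter_upwards [hnhds] with t ht
    exact hmax (hinv x _ ordConnected_Ioo h0 hx hm t ht)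
  have hd := hmaxl.hasDerivAt_eq_zero ((hx.hasDerivWithinAt_quad 1 h0).hasDerivAt hnhds)
  have h1 : ν + quad a (x 0) = 0 := by
    rcases mul_eq_zero.1 hd with h | h
    · linarith
    · exact absurd h hmpos.ne'
  have h2 := mul_quad_pos hα (hXS hm) hm0
  have h3 : α * (ν + quad a (x 0)) = 0 := by rw [h1, mul_zero]
  linarith

/-- For `ν = 0` no nonzero solution in the subspace returns to its initial point. -/
lemma no_return (hα : ∀ j ∈ S, 0 < α * a j) {y : ℝ → State n} {s : ℝ} (hs : 0 < s)
    (hy : Solves (eulerField ω a 0) y (Icc 0 s)) (hy0 : y 0 ∈ coordPlane S) (hne : y 0 ≠ 0) :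
    y s ≠ y 0 := by
  intro h
  obtain ⟨h1, h2⟩ := hy.eq_spiral ordConnected_Icc (left_mem_Icc.2 hs.le) hne (isScaling_zero a _)
    (right_mem_Icc.2 hs.le)
  have hq0 : quad a (y 0) ≠ 0 := fun h => by
    have := mul_quad_pos hα hy0 hne
    simp [h] at this
  have h3 := congrArg (quad a) h2
  rw [h, quad_spiral, inv_pow, Real.sq_sqrt h1.le] at h3
  have h4 : (1 - 2 * quad a (y 0) * s)⁻¹ = 1 := mul_right_cancel₀ hq0 (by linarith)
  have h5 : 2 * quad a (y 0) * s = 0 := by linarith [inv_eq_one.1 h4]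
  exact (mul_ne_zero (mul_ne_zero two_ne_zero hq0) hs.ne') h5

/-- For `α ν < 0` the dynamics is not equivalent to that for `ν = 0`, because it has a periodic orbit
in each plane. -/
lemma not_topEquivalentOn (hα : ∀ j ∈ S, 0 < α * a j) (hν : α * ν < 0) {i : Fin n} (hi : i ∈ S)
    (hω : ω i ≠ 0) :
    ¬ TopEquivalentOn (eulerField ω a ν) (eulerField ω a 0) (coordPlane S) := by
  rintro ⟨h, hmaps, -⟩
  have hν0 : ν ≠ 0 := by rintro rfl; simp at hν
  obtain ⟨p, hp, hpi⟩ := toralSet_nonempty hα hν (Finset.singleton_nonempty i)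
    (Finset.singleton_subset_iff.2 hi)
  have hpz : ∀ j, j ≠ i → p.1 j = 0 ∧ p.2 j = 0 := fun j hj => by
    rw [← radius_eq_zero]
    by_contra hr
    have := mem_supp.2 hr
    rw [hpi, Finset.mem_singleton] at this
    exact hj this
  have hscal : ∀ t, scaling a ν p t = 1 := fun t => by
    have : -quad a p / ν = 1 := by
      rw [div_eq_one_iff_eq hν0]
      linarith [hp.2]
    rw [scaling, this]
    ring
  set T := 2 * (Real.pi / |ω i|) with hT
  have hTpos : 0 < Real.pi / |ω i| := div_pos Real.pi_pos (abs_pos.2 hω)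
  set x : ℝ → State n := fun t => spiral ω (√(scaling a ν p t))⁻¹ t p with hx
  have hxs : ∀ t, x t = spiral ω 1 t p := fun t => by simp [hx, hscal]
  have hsol : Solves (eulerField ω a ν) x (Icc 0 T) :=
    (isScaling_scaling a hν0 p).solves fun t _ => by rw [hscal]; exact one_pos
  have hxD : ∀ t ∈ Icc 0 T, x t ∈ coordPlane S := fun t _ => spiral_mem_coordPlane hp.1 _ _
  have hx0 : x 0 = p := by rw [hxs, spiral_one_zero]
  -- the angles after a half and after a full period
  have hangle : ω i * (Real.pi / |ω i|) = Real.pi ∨ ω i * (Real.pi / |ω i|) = -Real.pi := by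
    rcases abs_cases (ω i) with ⟨h1, -⟩ | ⟨h1, -⟩
    · left; rw [h1]; field_simp
    · right; rw [h1]; field_simp
  have hxT : x T = p := by
    have hc : Real.cos (ω i * T) = 1 ∧ Real.sin (ω i * T) = 0 := by
      have : ω i * T = 2 * (ω i * (Real.pi / |ω i|)) := by rw [hT]; ring
      rw [this]
      rcases hangle with h | h <;> rw [h] <;> simp
    rw [hxs]
    refine Prod.ext (funext fun j => ?_) (funext fun j => ?_) <;>
    · by_cases hj : j = i
      · subst hj
        simp [spiral, hc.1, hc.2]
      · simp [spiral, hpz j hj]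
  have hxh : x (Real.pi / |ω i|) ≠ p := by
    intro heq
    have hc : Real.cos (ω i * (Real.pi / |ω i|)) = -1 ∧
        Real.sin (ω i * (Real.pi / |ω i|)) = 0 := by
      rcases hangle with h | h <;> rw [h] <;> simp
    rw [hxs] at heq
    have h1 := congrFun (congrArg Prod.fst heq) i
    have h2 := congrFun (congrArg Prod.snd heq) i
    simp only [spiral, hc.1, hc.2] at h1 h2
    have hr : radius p i = 0 := radius_eq_zero.2 ⟨by linarith, by linarith⟩
    have : i ∈ supp (radius p) := by rw [hpi]; exact Finset.mem_singleton_self i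
    exact mem_supp.1 this hr
  have h0 : (0 : ℝ) ∈ Icc 0 T := ⟨le_rfl, by linarith⟩
  have hh : Real.pi / |ω i| ∈ Icc 0 T := ⟨hTpos.le, by linarith⟩
  have hTT : T ∈ Icc 0 T := ⟨by linarith, le_rfl⟩
  obtain ⟨y, τ, -, hτ, hτ0, hy, hyx⟩ := hmaps x T (by linarith) hsol hxD
  have hτT : 0 < τ T := hτ0 ▸ hτ h0 hTT (by linarith)
  have hτh : τ (Real.pi / |ω i|) ∈ Icc 0 (τ T) := by
    rw [← hτ0]
    exact ⟨hτ.monotoneOn h0 hh hTpos.le, hτ.monotoneOn hh hTT (by linarith)⟩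
  have hy0 : y 0 = h ⟨x 0, hxD 0 h0⟩ := by rw [← hyx 0 h0, hτ0]
  have hne : y 0 ≠ 0 := by
    intro hy00
    -- the origin is an equilibrium, but the orbit of `p` is not a point
    have h1 : y (τ (Real.pi / |ω i|)) = y 0 := by
      rw [hy.eq_zero ordConnected_Icc ⟨le_rfl, hτT.le⟩ hy00 hτh, hy00]
    rw [hyx _ hh, hy0] at h1
    have h2 := congrArg Subtype.val (h.injective (Subtype.ext h1))
    exact hxh (h2.trans hx0)
  refine no_return hα hτT hy (hy0 ▸ (h _).2) hne ?_
  rw [hyx T hTT, hy0]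
  congr 2
  exact Subtype.ext (hxT.trans hx0.symm)

end Stability

/-! ### Trajectories in polar coordinates -/

lemma radius_mul_cos_arg {n : ℕ} (p : State n) (i : Fin n) :
    radius p i * Real.cos (Complex.arg ⟨p.1 i, p.2 i⟩) = p.1 i := by
  rw [radius_eq_norm, Complex.norm_mul_cos_arg]

lemma radius_mul_sin_arg {n : ℕ} (p : State n) (i : Fin n) :
    radius p i * Real.sin (Complex.arg ⟨p.1 i, p.2 i⟩) = p.2 i := by
  rw [radius_eq_norm, Complex.norm_mul_sin_arg]

section Trajectory

variable {n : ℕ} {ω a : Fin n → ℝ} {ν : ℝ} {x : ℝ → State n} {J : Set ℝ}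

/-- Each plane rotates with constant angular velocity. -/
lemma Solves.rotates (hJ : J.OrdConnected) (h0 : (0 : ℝ) ∈ J)
    (hx : Solves (eulerField ω a ν) x J) {t : ℝ} (ht : t ∈ J) (i : Fin n) :
    (x t).1 i = radius (x t) i *
        Real.cos (Complex.arg ⟨(x 0).1 i, (x 0).2 i⟩ + ω i * t) ∧
      (x t).2 i = radius (x t) i *
        Real.sin (Complex.arg ⟨(x 0).1 i, (x 0).2 i⟩ + ω i * t) := by
  obtain ⟨lam, hlam, h⟩ := hx.exists_eq_spiral hJ h0 ht
  have h1 := radius_mul_cos_arg (x 0) i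
  have h2 := radius_mul_sin_arg (x 0) i
  rw [h, radius_spiral ω hlam.le, Real.cos_add, Real.sin_add]
  simp only [spiral]
  constructor
  · linear_combination -lam * Real.cos (ω i * t) * h1 + lam * Real.sin (ω i * t) * h2
  · linear_combination -lam * Real.sin (ω i * t) * h1 - lam * Real.cos (ω i * t) * h2

/-- The nonzero radii satisfy `ρ' = g ρ`. -/
lemma Solves.hasDerivWithinAt_radius (hx : Solves (eulerField ω a ν) x J) {t : ℝ} (ht : t ∈ J)
    {i : Fin n} (hi : radius (x t) i ≠ 0) :
    HasDerivWithinAt (fun s => radius (x s) i) ((ν + quad a (x t)) * radius (x t) i) J t := by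
  have hsq := radius_sq (x t) i
  have hne : (x t).1 i ^ 2 + (x t).2 i ^ 2 ≠ 0 := by
    rw [← hsq]
    exact pow_ne_zero 2 hi
  have h := (((hx.hasDerivWithinAt_fst ht i).pow 2).add
    ((hx.hasDerivWithinAt_snd ht i).pow 2)).sqrt hne
  refine h.congr_deriv ?_
  change _ / (2 * radius (x t) i) = _
  rw [div_eq_iff (by positivity)]
  push_cast
  linear_combination -2 * (ν + quad a (x t)) * hsq

/-- The common factor `g`, expressed by one nonzero radius and the direction. -/
lemma add_quad_mul_radius {p : State n} (hp : p ≠ 0) {i q : Fin n} (hq : direction p q ≠ 0) :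
    (ν + quad a p) * radius p i = direction p i / direction p q * radius p q *
      (ν + radius p q ^ 2 * ∑ j, a j * (direction p j ^ 2 / direction p q ^ 2)) := by
  have h := stateNorm_mul_direction hp
  have hsum : ∑ j, a j * (direction p j ^ 2 / direction p q ^ 2) =
      (∑ j, a j * direction p j ^ 2) / direction p q ^ 2 := by
    rw [Finset.sum_div]
    exact Finset.sum_congr rfl fun j _ => (mul_div_assoc _ _ _).symm
  rw [quad_eq_of_radius a fun i => (h i).symm, hsum, ← h i, ← h q]
  field_simp

end Trajectory

end

theorem mainTheorem8 (n k : ℕ) (hk : 2 ≤ k) (hkn : k ≤ n)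
    (σ : Equiv.Perm (Fin n)) (hσ : σ ∈ shuffles n k)
    (ω a : Fin n → ℝ) (hω : ∀ i, ω i ≠ 0)
    (hsign : ∀ i j : Fin n, i < j → j.val < k → 0 < a (σ i) * a (σ j)) :
    -- `ν = 0` is a bifurcation value of the dynamics on the closed cell
    IsBifurcationValueOn (fun ν => eulerField ω a ν) (closure (stateCell n k σ)) 0 ∧
    -- the closed positive spherical cell is a CW complex with the cells `𝕊^{l,γ}_{>0}`
    ∃ _cw : Topology.CWComplex (closure (spherePos n k σ)),
      (∀ l : ℕ, Set.range (fun e : Topology.CWComplex.cell (closure (spherePos n k σ)) l =>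
          Topology.CWComplex.openCell (C := closure (spherePos n k σ)) l e) =
        {A | ∃ γ ∈ subShuffles n k σ (l + 1), A = spherePos n (l + 1) γ}) ∧
    ∃ X : ℝ → Set (State n),
      -- the toral CW complexes shrink to the origin
      (∀ U ∈ 𝓝 (0 : State n), ∀ᶠ ν in 𝓝 (0 : ℝ),
        a (σ ⟨k - 1, by omega⟩) * ν < 0 → X ν ⊆ U) ∧
      -- on the other side of, and at, the bifurcation value there is none
      (∀ ν : ℝ, 0 ≤ a (σ ⟨k - 1, by omega⟩) * ν →
        ¬ ∃ X' : Set (State n), X' ⊆ closure (stateCell n k σ) ∧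
          IsFlowInvariant (eulerField ω a ν) X' ∧ Nonempty (ToralQuotient n k σ ≃ₜ X')) ∧
      ∀ ν : ℝ, a (σ ⟨k - 1, by omega⟩) * ν < 0 →
        X ν ⊆ closure (stateCell n k σ) ∧ (0 : State n) ∉ X ν ∧
        IsFlowInvariant (eulerField ω a ν) (X ν) ∧
        -- its sections in the leaves are flow-invariant Clifford hypertori
        (∀ (l : ℕ) (γ : Equiv.Perm (Fin n)), 1 ≤ l → γ ∈ subShuffles n k σ l →
          ∀ C ∈ spherePos n l γ,
            IsFlowInvariant (eulerField ω a ν) (X ν ∩ leaf n l γ C) ∧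
            ∃ r : ℝ, 0 < r ∧ X ν ∩ leaf n l γ C = {p | ∀ i, radius p i = r * C i}) ∧
        -- it is a toral CW complex over the closed positive spherical cell, with odd cells only
        (∃ T : ToralCWComplex (closure (spherePos n k σ)) (X ν),
          ∀ e : CWCells (closure (spherePos n k σ)), Nat.card (T.circ e) = e.1 + 1 ∧
            ∀ γ ∈ subShuffles n k σ (e.1 + 1), cwOpen e = spherePos n (e.1 + 1) γ →
              (Subtype.val '' T.toralCell e : Set (State n)) =
                X ν ∩ stateCell n (e.1 + 1) γ) ∧
        -- it is homeomorphic to the quotient, compatibly with the partitions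
        (∃ H : ToralQuotient n k σ ≃ₜ X ν,
          ∀ (s : LabelledTorus n k σ) (x : closure (spherePos n k σ)) (l : ℕ)
            (γ : Equiv.Perm (Fin n)), 1 ≤ l → γ ∈ subShuffles n k σ l →
            (x : Fin n → ℝ) ∈ spherePos n l γ →
              (H (Quot.mk _ (s, x)) : State n) ∈ leaf n l γ x) ∧
        -- stability
        (AsymptoticallyStableOn (eulerField ω a ν) (closure (stateCell n k σ)) (X ν) ↔
          a (σ ⟨k - 1, by omega⟩) < 0) ∧
        (0 < a (σ ⟨k - 1, by omega⟩) →
          ¬ LyapunovStableOn (eulerField ω a ν) (closure (stateCell n k σ)) (X ν) ∧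
          ∃ U ∈ 𝓝ˢ (X ν), ∀ p ∈ closure (stateCell n k σ), p ∉ X ν →
            ∃ (T : ℝ) (x : ℝ → State n), 0 ≤ T ∧
              Solves (eulerField ω a ν) x (Set.Icc 0 T) ∧ x 0 = p ∧ x T ∉ U) ∧
        -- trajectories in the open cells of the closed cell
        ∀ (l : ℕ) (γ : Equiv.Perm (Fin n)), 1 ≤ l → γ ∈ subShuffles n k σ l →
          ∀ p ∈ stateCell n l γ,
            (a (σ ⟨k - 1, by omega⟩) < 0 →
              (∃ x : ℝ → State n, Solves (eulerField ω a ν) x (Set.Ici 0) ∧ x 0 = p) ∧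
              ∀ x : ℝ → State n, Solves (eulerField ω a ν) x (Set.Ici 0) → x 0 = p →
                ConvergesToSet x atTop (X ν)) ∧
            (0 < a (σ ⟨k - 1, by omega⟩) →
              (∃ x : ℝ → State n, Solves (eulerField ω a ν) x (Set.Iic 0) ∧ x 0 = p) ∧
              ∀ x : ℝ → State n, Solves (eulerField ω a ν) x (Set.Iic 0) → x 0 = p →
                ConvergesToSet x atBot (X ν)) ∧
            ∀ (x : ℝ → State n) (J : Set ℝ), J.OrdConnected → (0 : ℝ) ∈ J →
              Solves (eulerField ω a ν) x J → x 0 = p →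
              (∀ t ∈ J, x t ∈ leaf n l γ (direction p)) ∧
              ∃ θ : Fin n → ℝ, ∀ q : Fin n, q.val + 1 = l → ∀ i : Fin n, i.val < l → ∀ t ∈ J,
                (x t).1 (γ i) = radius (x t) (γ i) * Real.cos (θ i + ω (γ i) * t) ∧
                (x t).2 (γ i) = radius (x t) (γ i) * Real.sin (θ i + ω (γ i) * t) ∧
                HasDerivWithinAt (fun s => radius (x s) (γ i))
                  (direction p (γ i) / direction p (γ q) * radius (x t) (γ q) *
                    (ν + radius (x t) (γ q) ^ 2 *
                      ∑ j, a j * (direction p j ^ 2 / direction p (γ q) ^ 2))) J t := by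
  have hα0 : a (σ ⟨k - 1, by omega⟩) ≠ 0 := fun h => by
    have := hsign ⟨0, by omega⟩ ⟨k - 1, by omega⟩ (by simp [Fin.lt_def]; omega) (by simp; omega)
    simp [h] at this
  set α := a (σ ⟨k - 1, by omega⟩)
  have hα : ∀ j ∈ initialValues k σ, 0 < α * a j := by
    intro j hj
    obtain ⟨i, rfl⟩ := σ.surjective j
    rw [apply_mem_initialValues] at hj
    rcases eq_or_ne i ⟨k - 1, by omega⟩ with heq | hne
    · rw [heq]
      exact mul_self_pos.2 hα0
    · rw [mul_comm]
      refine hsign i ⟨k - 1, by omega⟩ (Fin.lt_def.2 ?_) (by simp; omega)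
      have : i.val ≠ k - 1 := fun h => hne (Fin.ext h)
      simp only
      omega
  have hk1 : 1 ≤ k := by omega
  have hi0 : σ ⟨0, by omega⟩ ∈ initialValues k σ := apply_mem_initialValues.2 (by simp; omega)
  have hC := closure_spherePos hk1 hkn σ
  let cw := faceComplex (initialValues k σ) _ hC
  let F := faceLabelling (initialValues k σ) _ hC
  simp only [closure_stateCell]
  refine ⟨?_, cw, F.range_openCell hkn rfl, fun ν => toralSet a ν (initialValues k σ), ?_, ?_, ?_⟩
  · intro U hU
    have hc : Continuous fun δ : ℝ => -α * δ := by fun_prop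
    have hlim : Tendsto (fun δ : ℝ => -α * δ) (𝓝[>] 0) (𝓝 0) := by
      simpa using (hc.tendsto 0).mono_left (nhdsWithin_le_nhds (s := Ioi 0))
    obtain ⟨δ, hδU, hδ⟩ := ((hlim.eventually hU).and self_mem_nhdsWithin).exists
    refine ⟨_, hδU, not_topEquivalentOn hα ?_ hi0 (hω _)⟩
    have h1 : 0 < δ := hδ
    have h2 := mul_pos (mul_self_pos.2 hα0) h1
    linarith
  · intro U hU
    filter_upwards [eventually_toralSet_subset hα hU] with ν hν _
    exact hν
  · rintro ν hν ⟨X', hX', hinv, ⟨H⟩⟩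
    have := compactSpace_toralQuotient hk1 hkn σ
    have hcomp : IsCompact X' := isCompact_iff_compactSpace.2 H.compactSpace
    have hsub := subset_zero_of_isFlowInvariant hα hν hcomp hX' hinv
    obtain ⟨u, v, huv⟩ := nontrivial_toralQuotient hk hkn σ
    refine huv (H.injective (Subtype.ext ?_))
    rw [hsub (H u).2, hsub (H v).2]
  intro ν hν
  have hν0 : ν ≠ 0 := by rintro rfl; simp at hν
  have hstab := fun h : α < 0 => asymptoticallyStableOn_toralSet (ω := ω) hα hν h
  have hunstab := fun h : 0 < α => not_lyapunovStableOn_toralSet (ω := ω) hα hν h ⟨_, hi0⟩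
  refine ⟨fun p hp => hp.1, fun h => ne_zero_of_mem_toralSet hν h rfl,
    isFlowInvariant_toralSet hν, ?_, ?_, ?_, ⟨fun h => ?_, hstab⟩, fun h => ⟨hunstab h, ?_⟩, ?_⟩
  · intro l γ _ hγ C hCγ
    have hsub := initialValues_subset hγ
    refine ⟨(isFlowInvariant_toralSet hν).inter (isFlowInvariant_leaf l γ C), ellRadius a ν C,
      ellRadius_pos hα hν ?_, toralSet_inter_leaf hα hν hsub hCγ⟩
    rw [spherePos_eq] at hCγ
    exact openFace_subset_closedFace hsub hCγ
  · refine ⟨toralComplex F hα hν, fun e => ⟨?_, fun γ hγ he => ?_⟩⟩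
    · change Nat.card {m // m ∈ F.face e} = e.1 + 1
      rw [Nat.card_eq_fintype_card, Fintype.card_coe, F.card_face]
    · have he' := openFace_injective (F.face_nonempty e)
        ((F.openCell_eq e).symm.trans (he.trans (spherePos_eq γ)))
      ext p
      constructor
      · rintro ⟨p, hp, rfl⟩
        exact ⟨p.2, mem_stateCell.2 (Eq.trans hp he')⟩
      · rintro ⟨hp, hpc⟩
        exact ⟨⟨p, hp⟩, (mem_stateCell.1 hpc).trans he'.symm, rfl⟩
  · obtain ⟨H, hH⟩ := exists_quotient_homeomorph hk1 hkn hα hν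
    refine ⟨H, fun s x l γ _ _ hx => ?_⟩
    rw [hH]
    exact quotientFun_mem_leaf hk1 hkn hα hν (s, x) hx
  · rcases lt_or_gt_of_ne hα0 with h0 | h0
    · exact h0
    · exact absurd h.1 (hunstab h0)
  · exact ⟨_, abs_add_quad_lt_mem_nhdsSet (half_pos (abs_pos.2 hν0)), fun p hp hpX =>
      escape_of_notMem hα hν h hp hpX⟩
  intro l γ hl hγ p hp
  have hpS : p ∈ coordPlane (initialValues k σ) :=
    mem_coordPlane.2 ((mem_stateCell.1 hp).subset.trans (initialValues_subset hγ))
  have hp0 : p ≠ 0 := by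
    rintro rfl
    exact hp.1 ⟨0, by omega⟩ (by simp; omega) rfl
  refine ⟨fun h => ?_, fun h => ?_, fun x J hJ h0 hx hx0 => ?_⟩
  · have hνpos : 0 < ν := pos_of_mul_neg_right hν h.le
    refine ⟨exists_solution hα hν hpS fun t ht => mul_nonneg hνpos.le ht, ?_⟩
    rintro x hx rfl
    exact convergesToSet_toralSet hα hν ordConnected_Ici self_mem_Ici hx hpS hp0
      (eventually_ge_atTop 0) (tendsto_exp_atTop hνpos)
  · have hνneg : ν < 0 := neg_of_mul_neg_right hν h.le
    refine ⟨exists_solution hα hν hpS fun t ht => mul_nonneg_of_nonpos_of_nonpos hνneg.le ht, ?_⟩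
    rintro x hx rfl
    exact convergesToSet_toralSet hα hν ordConnected_Iic self_mem_Iic hx hpS hp0
      (eventually_le_atBot 0) (tendsto_exp_atBot hνneg)
  · subst hx0
    have hleaf := isFlowInvariant_leaf l γ (direction (x 0)) x J hJ h0 hx ⟨hp, rfl⟩
    refine ⟨hleaf, fun i => Complex.arg ⟨(x 0).1 (γ i), (x 0).2 (γ i)⟩,
      fun q hq i hi t ht => ⟨(hx.rotates hJ h0 ht (γ i)).1, (hx.rotates hJ h0 ht (γ i)).2, ?_⟩⟩
    have hrad : ∀ j : Fin n, j.val < l → radius (x t) (γ j) ≠ 0 := fun j hj =>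
      mem_supp.1 (by rw [mem_stateCell.1 (hleaf t ht).1]; exact apply_mem_initialValues.2 hj)
    have hxt0 : x t ≠ 0 := fun h => hrad i hi (by simp [h, radius])
    have hdq : direction (x t) (γ q) ≠ 0 := fun h => hrad q (by omega) (by
      rw [← stateNorm_mul_direction hxt0, h, mul_zero])
    rw [← (hleaf t ht).2, ← add_quad_mul_radius hxt0 hdq]
    exact hx.hasDerivWithinAt_radius ht (hrad i hi)
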